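/- **Setting.** Let $X,Y$ be complex Banach spaces, $A:D(A)\subset X\to X$ and $\partial:D(A)\to Y$ linear with $[A,\partial]^T$ closed. Assume that $A_0=A|_{\operatorname{Ker}\partial}$ generates a $C_0$-semigroup with $\|S_{A_0}(t)\|\le Me^{\omega t}$, $\omega<0$, and that there is a bounded $E:Y\to X$ with $EY\subset D(A)$, $\partial E=I$ and $AE$ bounded. $K(0):Y\to X$ maps $v$ to the unique $x\in D(A)$ with $Ax=0$, $\partial x=v$. Let $W,Z$ be Banach spaces continuously embedded in $X,Y$ with $W\subset D(A)$, $K(0)Z\subset W$, $\partial W\subset Z$, and let $W_0=W\cap\operatorname{Ker}\partial$ with the norm of $W$. *Rational approximation.* $r(z)=r_\infty+\sum_{l=1}^k\sum_{j=1}^{m_l}r_{lj}(1-zw_l)^{-j}$, $\operatorname{Re}w_l>0$, satisfies $|r(z)|\le1$ for $\operatorname{Re}z\le0$ and $r(z)-e^z=O(z^{p+1})$ as $z\to0$, where $p\ge1$. *RL method.* Let $t_n=n\tau$, $\tau>0$. For all $n\ge 0$ let $c_n\in\mathbb R^p$ and $d_n\in\mathbb R^{p+1}$ have pairwise different components, with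 $t_n+\tau c_{n}\ge0$ and $t_n+\tau d_{n}\ge0$ componentwise. Let $\gamma_{n,l,i}\in\mathbb C^p$ and $\eta_{n,l,i}\in\mathbb C^{p+1}$ be the solutions of the Vandermonde systems $\sum_\nu c_{n,\nu}^j\gamma_\nu=R^{(j)}(0)$, $0\le j\le p-1$, for $R(z)=(1-w_lz)^{-i}$, and $\sum_\nu d_{n,\nu}^j\eta_\nu=R^{(j)}(0)$, $0\le j\le p$, for $R(z)=z(1-w_lz)^{-i}$. For a problem $u'=Bu+\phi-\mathcal K\psi'$, $u(0)=u_0$, the RL method is $\bar u_0=u_0$, $$\bar u_{n+1}=r(\tau B)\bar u_n+\sum_{l,j}r_{lj}w_l\sum_{i=1}^j(I-\tau w_lB)^{-(j-i+1)}\Big(\tau\sum_\nu\gamma_{n,l,i,\nu}\,\phi(t_n+\tau c_{n,\nu})-\mathcal K\sum_\nu\eta_{n,l,i,\nu}\,\psi(t_n+\tau d_{n,\nu})\Big).$$ Put $\kappa_n=1+\sum_{l=1}^k\sum_{i=1}^{m_l}\big(\sum_\nu|\gamma_{n,l,i,\nu}||c_{n,\nu}|^p+\sum_\nu|\eta_{n,l,i,\nu}|(|d_{n,\nu}|+|d_{n,\nu}|^{p+1})\big)$.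 *Space discretization.* For $0<h\le h_0$ let $X_h,Y_h$ be finite-dimensional complex normed spaces, $P_h:X\to X_h$ and $Q_h:Y\to Y_h$ bounded, $\partial_h:X_h\to Y_h$ onto, $X_{h,0}=\operatorname{Ker}\partial_h$, $A_h:X_h\to X_h$ and $A_{h,0}:X_{h,0}\to X_{h,0}$ with $A_h=A_{h,0}$ on $X_{h,0}$, $K_h:Y_h\to X_h$, $K_{h,0}:Y_h\to X_{h,0}$, and $P_{h,0}:X\to X_{h,0}$ bounded, all linear. Assume that $$L=\sup_h\max\{\|P_h\|,\|P_{h,0}\|,\|Q_h\|\},\quad M_s=\sup_{h,\;t\ge0}\|e^{tA_{h,0}}\|,\quad C_s=\sup_{h,\;\tau>0,\;n\ge0}\|r(\tau A_{h,0})^n\|$$ are finite, that $\|P_h-P_{h,0}\|_{W_0\to X_h}\le C'\|\partial_hP_h\|_{W_0\to Y_h}$ with $C'$ independent of $h$, and that, for some $\varepsilon:(0,h_0]\to(0,\infty)$ with $\varepsilon(h)\to0$ as $h\to0+$, the four norms $$\|A_{h,0}P_{h,0}-P_{h,0}A_0\|_{W_0\to X_h},\quad \|\partial_hP_h\|_{W_0\to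 Y_h},\quad \|P_hK(0)-K_hQ_h\|_{Z\to X_h},\quad \|P_{h,0}K(0)-K_{h,0}Q_h\|_{Z\to X_{h,0}}$$ are $O(\varepsilon(h))$, uniformly for $0<h\le h_0$. *Norms.* $\|v\|_{m,t}=\max_{0\le j\le m}\sup_{0\le s\le t}\|v^{(j)}(s)\|$ (in $X$ or $Y$; in $W$ for $\|\cdot\|_{m,t,W}$), and $|||[v,\phi,\psi]^T|||_{m,t}=\|v\|_{m,t}+\|\phi\|_{m,t}+\|\psi\|_{m+1,t}$. $\mathcal C^m_{ub}$ denotes the $\mathcal C^m$ functions whose derivatives of orders $0,\dots,m$ are bounded and uniformly continuous. **Theorem.** There are constants $C_{el},C_{aux}\ge0$ depending only on $r$ and $p$, and, for every setting as above and every $\bar\kappa\in\mathbb R$, a constant $C\ge0$ (independent of $h$, $\tau$, $n$, of the nodes and of $w_0,f,g,w$) such that the following holds. Let $w$ be a solution of $$w'(t)=Aw(t)+f(t),\qquad w(0)=w_0,\qquad \partial w(t)=g(t),\qquad t\ge0,$$ with $w\in\mathcal C^1_{ub}([0,\infty),W)\cap\mathcal C^{p+1}_{ub}([0,\infty),X)$,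 $f\in\mathcal C^{p+1}_{ub}([0,\infty),X)$, $g\in\mathcal C^{p+2}_{ub}([0,\infty),Z)$. Let $0<h\le h_0$, $\tau>0$, $n\ge0$, let $\kappa_j\le\bar\kappa$ for $0\le j<n$, and let $T\ge t_n$ be such that all the nodes $t_j+\tau c_{j,\nu}$, $t_j+\tau d_{j,\nu}$ with $0\le j<n$ lie in $[0,T]$ (so $T=t_n$ is allowed when no node used in the first $n$ steps exceeds $t_n$). Let $\bar w_{h,n}=K_hQ_hg(t_n)+\bar u_{h,n}$, where $\bar u_{h,n}$ is the result of the RL method applied in $X_{h,0}$ to $$u_h'=A_{h,0}u_h+P_{h,0}f-K_{h,0}Q_hg',\qquad u_h(0)=P_{h,0}w_0-K_{h,0}Q_hg(0).$$ Then $\|\bar w_{h,n}-P_hw(t_n)\|_h\le ERT_n(\tau)+ERS_n(h)$, where $$ERT_n(\tau)=C_c\,\tau^pt_n(1+2t_n)\big\{|||[w,f,g]^T|||_{p+1,T}+\|K(0)\|\,\|g\|_{p+2,T}\big\},\qquad C_c=C_sM_sL\,\big(C_{el}+\bar\kappa\,C_{aux}(1+\|K(0)\|)\big),$$ $$ERS_n(h)=(1+t_nM_s)\,C\,\varepsilon(h)\,\|w\|_{1,T,W}.$$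 -/

import Mathlib

open Set Filter Topology

namespace RLMethod

noncomputable section

/-! ### Function spaces on `[0, ∞)` -/

/-- `h` (restricted to `[0, ∞)`) is of class `C^m` and its derivatives of order `0, …, m` are bounded
and uniformly continuous on `[0, ∞)`. Derivatives at `0` are one-sided; values of `h` at negative
times play no role. -/
def IsCub {V : Type*} [NormedAddCommGroup V] [NormedSpace ℝ V] (m : ℕ) (h : ℝ → V) : Prop :=
  ContDiffOn ℝ m h (Ici 0) ∧
    ∀ j ≤ m, (∃ B : ℝ, ∀ t ∈ Ici (0 : ℝ), ‖iteratedDerivWithin j h (Ici 0) t‖ ≤ B) ∧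
      UniformContinuousOn (iteratedDerivWithin j h (Ici 0)) (Ici 0)

/-- `‖h‖_{m,t} = max_{0 ≤ j ≤ m} sup_{0 ≤ s ≤ t} ‖h^{(j)}(s)‖`. -/
def cNorm {V : Type*} [NormedAddCommGroup V] [NormedSpace ℝ V] (m : ℕ) (t : ℝ) (h : ℝ → V) : ℝ :=
  ⨆ j : Fin (m + 1), ⨆ s : Icc (0 : ℝ) t, ‖iteratedDerivWithin (j : ℕ) h (Ici 0) (s : ℝ)‖

/-- `|||[v, φ, ψ]|||_{m,t} = ‖v‖_{m,t} + ‖φ‖_{m,t} + ‖ψ‖_{m+1,t}`. -/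
def tripleNorm {V U : Type*} [NormedAddCommGroup V] [NormedSpace ℝ V]
    [NormedAddCommGroup U] [NormedSpace ℝ U] (m : ℕ) (t : ℝ) (v φ : ℝ → V) (ψ : ℝ → U) : ℝ :=
  cNorm m t v + cNorm m t φ + cNorm (m + 1) t ψ

/-! ### Rational approximations of the exponential -/

/-- The data of an expansion into simple fractions
`r(z) = r_∞ + ∑_{l} ∑_{j=1}^{m_l} r_{lj} / (1 - z w_l)^j` with `Re w_l > 0`. -/
structure SimpleFractions where
  /-- number of different poles -/
  k : ℕ
  /-- multiplicities -/
  m : Fin k → ℕ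
  /-- value at infinity -/
  rInf : ℂ
  /-- coefficients `r_{lj}`, used for `1 ≤ j ≤ m l` -/
  coeff : Fin k → ℕ → ℂ
  /-- reciprocals of the poles -/
  w : Fin k → ℂ
  w_re_pos : ∀ l, 0 < (w l).re

namespace SimpleFractions

/-- The rational function `r(z)`. -/
def eval (r : SimpleFractions) (z : ℂ) : ℂ :=
  r.rInf + ∑ l : Fin r.k, ∑ j ∈ Finset.Icc 1 (r.m l), r.coeff l j / (1 - z * r.w l) ^ j

/-- A-acceptability: `|r(z)| ≤ 1` for `Re z ≤ 0`. -/
def AAcceptable (r : SimpleFractions) : Prop := ∀ z : ℂ, z.re ≤ 0 → ‖r.eval z‖ ≤ 1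

/-- Order `p`: `r(z) - e^z = O(z^{p+1})` as `z → 0`. -/
def HasOrder (r : SimpleFractions) (p : ℕ) : Prop :=
  (fun z : ℂ => r.eval z - Complex.exp z) =O[𝓝 0] (fun z : ℂ => z ^ (p + 1))

variable {V : Type*} [NormedAddCommGroup V] [NormedSpace ℂ V]

/-- The operator `(I - τ w_l A)^{-1}`. -/
def resolv (r : SimpleFractions) (τ : ℝ) (A : V →L[ℂ] V) (l : Fin r.k) : V →L[ℂ] V :=
  Ring.inverse (1 - ((τ : ℂ) * r.w l) • A)

/-- `r(τA) = r_∞ I + ∑_l ∑_j r_{lj} (I - τ w_l A)^{-j}`. -/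
def evalOp (r : SimpleFractions) (τ : ℝ) (A : V →L[ℂ] V) : V →L[ℂ] V :=
  r.rInf • (1 : V →L[ℂ] V) +
    ∑ l : Fin r.k, ∑ j ∈ Finset.Icc 1 (r.m l), r.coeff l j • (r.resolv τ A l) ^ j

end SimpleFractions

/-! ### The RL method -/

/-- The solution `γ ∈ ℂ^q` of the Vandermonde system `∑_i c_i^j γ_i = j! R_j`, `0 ≤ j ≤ q - 1`, where
`R_j` are the Taylor coefficients of `R` at `0`, so that `j! R_j = R^{(j)}(0)`. -/
def nodeWeights {q : ℕ} (c : Fin q → ℝ) (R : ℂ → ℂ) : Fin q → ℂ :=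
  Matrix.mulVec ((Matrix.vandermonde (fun i => (c i : ℂ))).transpose)⁻¹
    (fun j => iteratedDeriv (j : ℕ) R 0)

/-- The weights `γ_{l,i}`, for the rational mapping `(1 - w_l z)^{-i}`. -/
def gammaW (r : SimpleFractions) {q : ℕ} (c : Fin q → ℝ) (l : Fin r.k) (i : ℕ) : Fin q → ℂ :=
  nodeWeights c (fun z => 1 / (1 - r.w l * z) ^ i)

/-- The weights `η_{l,i}`, for the rational mapping `z (1 - w_l z)^{-i}`. -/
def etaW (r : SimpleFractions) {q : ℕ} (d : Fin q → ℝ) (l : Fin r.k) (i : ℕ) : Fin q → ℂ :=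
  nodeWeights d (fun z => z / (1 - r.w l * z) ^ i)

/-- An explicit constant `κ(c, d)` measuring the influence of the auxiliary nodes of one step. -/
def kappa (r : SimpleFractions) (p : ℕ) (c : Fin p → ℝ) (d : Fin (p + 1) → ℝ) : ℝ :=
  1 + ∑ l : Fin r.k, ∑ i ∈ Finset.Icc 1 (r.m l),
    (∑ k, ‖gammaW r c l i k‖ * |c k| ^ p +
      ∑ k, ‖etaW r d l i k‖ * (|d k| + |d k| ^ (p + 1)))

/-- Admissible auxiliary nodes: for every `n` the components of `c_n ∈ ℝ^p` (resp. `d_n ∈ ℝ^{p+1}`) are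
pairwise different and `t_n + τ c_n ≥ 0`, `t_n + τ d_n ≥ 0` (with `t_n = n τ`, `τ > 0`). -/
def AdmissibleNodes (p : ℕ) (c : ℕ → Fin p → ℝ) (d : ℕ → Fin (p + 1) → ℝ) : Prop :=
  ∀ n, Function.Injective (c n) ∧ Function.Injective (d n) ∧
    (∀ k, 0 ≤ (n : ℝ) + c n k) ∧ (∀ k, 0 ≤ (n : ℝ) + d n k)

section Method

variable {V U : Type*} [NormedAddCommGroup V] [NormedSpace ℂ V]
  [NormedAddCommGroup U] [NormedSpace ℂ U]

/-- `E_n(τ) f = ∑_l ∑_j r_{lj} w_l ∑_{i=1}^j (I - τ w_l A)^{-j+i-1} γ_{n,l,i}^T · f(t_n + τ c_n)`,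
where `t = t_n` and `c = c_n`. -/
def stepE (r : SimpleFractions) (τ : ℝ) (A : V →L[ℂ] V) {q : ℕ} (c : Fin q → ℝ) (t : ℝ)
    (f : ℝ → V) : V :=
  ∑ l : Fin r.k, ∑ j ∈ Finset.Icc 1 (r.m l), (r.coeff l j * r.w l) •
    ∑ i ∈ Finset.Icc 1 j, ((r.resolv τ A l) ^ (j + 1 - i))
      (∑ k, gammaW r c l i k • f (t + τ * c k))

/-- `F_n(τ) g = ∑_l ∑_j r_{lj} w_l ∑_{i=1}^j (I - τ w_l A)^{-j+i-1} K η_{n,l,i}^T · g(t_n + τ d_n)`,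
where `t = t_n` and `d = d_n`. -/
def stepF (r : SimpleFractions) (τ : ℝ) (A : V →L[ℂ] V) (K : U →L[ℂ] V) {q : ℕ} (d : Fin q → ℝ)
    (t : ℝ) (g : ℝ → U) : V :=
  ∑ l : Fin r.k, ∑ j ∈ Finset.Icc 1 (r.m l), (r.coeff l j * r.w l) •
    ∑ i ∈ Finset.Icc 1 j, ((r.resolv τ A l) ^ (j + 1 - i))
      (K (∑ k, etaW r d l i k • g (t + τ * d k)))

/-- The RL method with step size `τ` for `u' = A u + f - K g'`, `u(0) = u₀`:
`u_{n+1} = r(τA) u_n + τ E_n(τ) f - F_n(τ) g`. -/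
def rlMethod (r : SimpleFractions) (τ : ℝ) (A : V →L[ℂ] V) (K : U →L[ℂ] V) {p : ℕ}
    (c : ℕ → Fin p → ℝ) (d : ℕ → Fin (p + 1) → ℝ) (f : ℝ → V) (g : ℝ → U) (u₀ : V) : ℕ → V
  | 0 => u₀
  | n + 1 => r.evalOp τ A (rlMethod r τ A K c d f g u₀ n)
      + (τ : ℂ) • stepE r τ A (c n) (n * τ) f - stepF r τ A K (d n) (n * τ) g

end Method

/-! ### The continuous problem -/

/-- A `C₀`-semigroup of bounded linear operators on `X` (only `t ≥ 0` is relevant). -/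
structure C0Semigroup (X : Type*) [NormedAddCommGroup X] [NormedSpace ℂ X] where
  S : ℝ → X →L[ℂ] X
  map_zero : S 0 = 1
  map_add : ∀ s t, 0 ≤ s → 0 ≤ t → S (s + t) = S s * S t
  strong_cont : ∀ x, ContinuousOn (fun t => S t x) (Ici 0)

/-- `B` is the infinitesimal generator of the semigroup: `x ∈ D(B)` and `B x = y` if and only if
`(S(t) x - x) / t → y` as `t → 0+`. -/
def C0Semigroup.IsGenerator {X : Type*} [NormedAddCommGroup X] [NormedSpace ℂ X]
    (T : C0Semigroup X) (B : X →ₗ.[ℂ] X) : Prop :=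
  ∀ x y : X, (∃ hx : x ∈ B.domain, B ⟨x, hx⟩ = y) ↔
    Tendsto (fun t : ℝ => ((t⁻¹ : ℝ) : ℂ) • (T.S t x - x)) (𝓝[>] 0) (𝓝 y)

/-- `A₀`, the restriction of `A` to `Ker ∂`. -/
def kerRestrict {X Y : Type*} [NormedAddCommGroup X] [NormedSpace ℂ X]
    [NormedAddCommGroup Y] [NormedSpace ℂ Y] (A : X →ₗ.[ℂ] X) (bd : A.domain →ₗ[ℂ] Y) :
    X →ₗ.[ℂ] X :=
  A.domRestrict ((LinearMap.ker bd).map A.domain.subtype)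

/-- The pair `A : D(A) ⊂ X → X`, `∂ : D(A) ⊂ X → Y` with `[A, ∂]` closed, such that
the restriction `A₀` of `A` to `Ker ∂` generates a `C₀`-semigroup of negative type, and such that there
is a bounded extension operator `E : Y → D(A)`, `∂E = I`, with `AE` bounded. -/
structure BoundaryProblem (X Y : Type*) [NormedAddCommGroup X] [NormedSpace ℂ X]
    [NormedAddCommGroup Y] [NormedSpace ℂ Y] where
  A : X →ₗ.[ℂ] X
  bd : A.domain →ₗ[ℂ] Y
  closed : IsClosed {q : X × X × Y | ∃ x : A.domain, q = ((x : X), A x, bd x)}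
  exists_semigroup : ∃ T : C0Semigroup X, T.IsGenerator (kerRestrict A bd) ∧
    ∃ M ω : ℝ, 1 ≤ M ∧ ω < 0 ∧ ∀ t, 0 ≤ t → ‖T.S t‖ ≤ M * Real.exp (ω * t)
  exists_extension : ∃ E AE : Y →L[ℂ] X, ∀ v, ∃ hv : E v ∈ A.domain,
    bd ⟨E v, hv⟩ = v ∧ A ⟨E v, hv⟩ = AE v

section Continuous

variable {X Y : Type*} [NormedAddCommGroup X] [NormedSpace ℂ X]
  [NormedAddCommGroup Y] [NormedSpace ℂ Y]

open Classical in
/-- `K(0) : Y → X`, the bounded operator that maps `v` to the solution `w ∈ D(A)` of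
`A w = 0`, `∂ w = v`. -/
def BoundaryProblem.K0 (P : BoundaryProblem X Y) : Y →L[ℂ] X :=
  if h : ∃ K : Y →L[ℂ] X, ∀ v, ∃ hv : K v ∈ P.A.domain,
      P.A ⟨K v, hv⟩ = 0 ∧ P.bd ⟨K v, hv⟩ = v
  then h.choose else 0

/-- Consistency spaces: `W` and `Z`, continuously embedded in `X` and `Y`, with
`W ⊂ D(A)`, `K(0) Z ⊂ W` and `∂ W ⊂ Z`. -/
structure ConsistencySpaces (P : BoundaryProblem X Y) (W Z : Type*)
    [NormedAddCommGroup W] [NormedSpace ℂ W] [NormedAddCommGroup Z] [NormedSpace ℂ Z] where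
  incW : W →L[ℂ] X
  incW_injective : Function.Injective incW
  incW_mem : ∀ w, incW w ∈ P.A.domain
  incZ : Z →L[ℂ] Y
  incZ_injective : Function.Injective incZ
  K0_mem : ∀ z, ∃ w, incW w = P.K0 (incZ z)
  bd_mem : ∀ w, ∃ z, incZ z = P.bd ⟨incW w, incW_mem w⟩

variable {W Z : Type*} [NormedAddCommGroup W] [NormedSpace ℂ W]
  [NormedAddCommGroup Z] [NormedSpace ℂ Z]

namespace ConsistencySpaces

variable {P : BoundaryProblem X Y} (S : ConsistencySpaces P W Z)

/-- The inclusion of `W` in `D(A)`. -/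
def toDomain : W →ₗ[ℂ] P.A.domain :=
  LinearMap.codRestrict P.A.domain S.incW.toLinearMap S.incW_mem

/-- `W₀ = Ker ∂ ∩ W`, with the norm of `W`. -/
def W0 : Submodule ℂ W := LinearMap.ker (P.bd.comp S.toDomain)

/-- `w : [0, ∞) → W` is a genuine solution of `w' = A w + f`, `w(0) = w₀`, `∂ w = g`. -/
def IsSolution (w₀ : X) (f : ℝ → X) (g : ℝ → Z) (w : ℝ → W) : Prop :=
  S.incW (w 0) = w₀ ∧
    ∀ t, 0 ≤ t →
      HasDerivWithinAt (fun s => S.incW (w s)) (P.A (S.toDomain (w t)) + f t) (Ici 0) t ∧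
      P.bd (S.toDomain (w t)) = S.incZ (g t)

end ConsistencySpaces

end Continuous

/-! ### The space discretization -/

/-- The semigroup `S_A(t) = exp(t A)` generated by a bounded operator `A`. -/
def expSemigroup {V : Type*} [NormedAddCommGroup V] [NormedSpace ℂ V] (A : V →L[ℂ] V) (t : ℝ) :
    V →L[ℂ] V :=
  NormedSpace.exp ((t : ℂ) • A)

/-- The operators of a space discretization with parameter `h ∈ (0, h₀]`. -/
structure SpaceDiscretization (X Y : Type*) [NormedAddCommGroup X] [NormedSpace ℂ X]
    [NormedAddCommGroup Y] [NormedSpace ℂ Y] (h₀ : ℝ) (Xh Yh : Ioc (0 : ℝ) h₀ → Type*)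
    [∀ h, NormedAddCommGroup (Xh h)] [∀ h, NormedSpace ℂ (Xh h)]
    [∀ h, NormedAddCommGroup (Yh h)] [∀ h, NormedSpace ℂ (Yh h)] where
  Ph : ∀ h, X →L[ℂ] Xh h
  Qh : ∀ h, Y →L[ℂ] Yh h
  bdh : ∀ h, Xh h →L[ℂ] Yh h
  bdh_surjective : ∀ h, Function.Surjective (bdh h)
  Ah : ∀ h, Xh h →L[ℂ] Xh h
  /-- `A_{h,0}`, acting on `X_{h,0} = Ker ∂_h` -/
  Ah0 : ∀ h, (bdh h).ker →L[ℂ] (bdh h).ker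
  Ah_eq : ∀ h (x : (bdh h).ker), Ah h x = Ah0 h x
  Kh : ∀ h, Yh h →L[ℂ] Xh h
  Ph0 : ∀ h, X →L[ℂ] (bdh h).ker
  Kh0 : ∀ h, Yh h →L[ℂ] (bdh h).ker

namespace SpaceDiscretization

variable {X Y : Type*} [NormedAddCommGroup X] [NormedSpace ℂ X]
  [NormedAddCommGroup Y] [NormedSpace ℂ Y] {h₀ : ℝ} {Xh Yh : Ioc (0 : ℝ) h₀ → Type*}
  [∀ h, NormedAddCommGroup (Xh h)] [∀ h, NormedSpace ℂ (Xh h)]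
  [∀ h, NormedAddCommGroup (Yh h)] [∀ h, NormedSpace ℂ (Yh h)]
  (D : SpaceDiscretization X Y h₀ Xh Yh)

/-- `max {‖P_h‖, ‖P_{h,0}‖, ‖Q_h‖}`. -/
def Lh (h : Ioc (0 : ℝ) h₀) : ℝ := max ‖D.Ph h‖ (max ‖D.Ph0 h‖ ‖D.Qh h‖)

/-- `L = sup_h L_h`. -/
def L : ℝ := ⨆ h, D.Lh h

/-- `‖S_{A_{h,0}}(t)‖`, where `S_{A_{h,0}}(t) = exp(t A_{h,0})`. -/
def semigroupNorm (q : Ioc (0 : ℝ) h₀ × Ici (0 : ℝ)) : ℝ :=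
  ‖expSemigroup (D.Ah0 q.1) (q.2 : ℝ)‖

/-- `M_s = sup_h sup_{t ≥ 0} ‖S_{A_{h,0}}(t)‖`. -/
def Ms : ℝ := ⨆ q, D.semigroupNorm q

/-- `‖r(τ A_{h,0})^n‖`. -/
def powerNorm (r : SimpleFractions) (q : Ioc (0 : ℝ) h₀ × Ioi (0 : ℝ) × ℕ) : ℝ :=
  ‖(r.evalOp (q.2.1 : ℝ) (D.Ah0 q.1)) ^ q.2.2‖

/-- `C_s = sup_h sup_{τ > 0} sup_n ‖r(τ A_{h,0})^n‖`. -/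
def Cs (r : SimpleFractions) : ℝ := ⨆ q, D.powerNorm r q

/-- The stability hypotheses: `L`, `M_s` and `C_s` are finite. -/
structure Stable (r : SimpleFractions) : Prop where
  bddL : BddAbove (range D.Lh)
  bddMs : BddAbove (range D.semigroupNorm)
  bddCs : BddAbove (range (D.powerNorm r))

/-- The consistency hypotheses, with respect to an infinitesimum `ε : (0, h₀] → (0, ∞)`. An operator
norm estimate `‖T‖_{W₀ → V} ≤ a` is written as `‖T w‖ ≤ a ‖w‖_W` for `w ∈ W₀`; the constants in the
`O(ε(h))` bounds are uniform in `h`. -/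
structure Consistent {W Z : Type*} [NormedAddCommGroup W] [NormedSpace ℂ W]
    [NormedAddCommGroup Z] [NormedSpace ℂ Z] {P : BoundaryProblem X Y}
    (S : ConsistencySpaces P W Z) (ε : Ioc (0 : ℝ) h₀ → ℝ) : Prop where
  eps_pos : ∀ h, 0 < ε h
  eps_tendsto : Tendsto ε (comap Subtype.val (𝓝[>] 0)) (𝓝 0)
  /-- `‖P_h - P_{h,0}‖_{W₀ → X_h} ≤ C' ‖∂_h P_h‖_{W₀ → Y_h}` -/
  proj : ∃ C' : ℝ, ∀ h, ∀ w ∈ S.W0,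
    ‖D.Ph h (S.incW w) - (D.Ph0 h (S.incW w) : Xh h)‖ ≤
      C' * ‖((D.bdh h).comp ((D.Ph h).comp S.incW)).comp S.W0.subtypeL‖ * ‖w‖
  /-- `‖A_{h,0} P_{h,0} - P_{h,0} A₀‖_{W₀ → X_h} = O(ε(h))` -/
  C1 : ∃ C : ℝ, ∀ h, ∀ w ∈ S.W0,
    ‖D.Ah0 h (D.Ph0 h (S.incW w)) - D.Ph0 h (P.A (S.toDomain w))‖ ≤ C * ε h * ‖w‖
  /-- `‖∂_h P_h‖_{W₀ → Y_h} = O(ε(h))` -/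
  C2 : ∃ C : ℝ, ∀ h, ∀ w ∈ S.W0, ‖D.bdh h (D.Ph h (S.incW w))‖ ≤ C * ε h * ‖w‖
  /-- `‖P_h K(0) - K_h Q_h‖_{Z → X_h} = O(ε(h))` -/
  C3 : ∃ C : ℝ, ∀ h, ∀ z : Z,
    ‖D.Ph h (P.K0 (S.incZ z)) - D.Kh h (D.Qh h (S.incZ z))‖ ≤ C * ε h * ‖z‖
  /-- `‖P_{h,0} K(0) - K_{h,0} Q_h‖_{Z → X_{h,0}} = O(ε(h))` -/
  C4 : ∃ C : ℝ, ∀ h, ∀ z : Z,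
    ‖D.Ph0 h (P.K0 (S.incZ z)) - D.Kh0 h (D.Qh h (S.incZ z))‖ ≤ C * ε h * ‖z‖

/-- `u_{h,n}`: the RL method applied to the semidiscrete problem in `X_{h,0}`
`u_h' = A_{h,0} u_h + P_{h,0} f - K_{h,0} Q_h g'`, `u_h(0) = P_{h,0} w₀ - K_{h,0} Q_h g(0)`. -/
def uFull (r : SimpleFractions) {p : ℕ} (c : ℕ → Fin p → ℝ) (d : ℕ → Fin (p + 1) → ℝ) (τ : ℝ)
    (w₀ : X) (f : ℝ → X) (g : ℝ → Y) (h : Ioc (0 : ℝ) h₀) (n : ℕ) : (D.bdh h).ker :=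
  rlMethod r τ (D.Ah0 h) (D.Kh0 h) c d (fun t => D.Ph0 h (f t)) (fun t => D.Qh h (g t))
    (D.Ph0 h w₀ - D.Kh0 h (D.Qh h (g 0))) n

/-- The full discretization `w_{h,n} = K_h Q_h g(t_n) + u_{h,n}`. -/
def wFull (r : SimpleFractions) {p : ℕ} (c : ℕ → Fin p → ℝ) (d : ℕ → Fin (p + 1) → ℝ) (τ : ℝ)
    (w₀ : X) (f : ℝ → X) (g : ℝ → Y) (h : Ioc (0 : ℝ) h₀) (n : ℕ) : Xh h :=
  D.Kh h (D.Qh h (g (n * τ))) + (D.uFull r c d τ w₀ f g h n : Xh h)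

end SpaceDiscretization

end

end RLMethod

namespace RLMethod

/-! ### Taylor coefficients at the origin -/

/-! The numerical solution is compared with a projection of the exact one, and all Taylor expansions
are algebraic; no variation-of-constants formula is used. Let `v₀ = w - K(0) g`. It lies in `W₀`,
and `A v₀ = A w`. With `y = P_{h,0} v₀`, `φ = P_{h,0} f`, `ψ = P_{h,0} K(0) g`, the equation `y' =
A_{h,0} y + φ - ψ'` holds up to the consistency error of `A_{h,0}` on `v₀`, which is `O(ε(h))`. The
method uses `K_{h,0} Q_h g` in place of `ψ`. The difference `θ` is Lipschitz in time with constant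
`O(ε(h))`, because `w` is `C¹` with values in `W`, and the weights `η` annihilate constants, so the
replacement costs only `O(τ ε(h))` per step.

One step is exact on jets: replacing `y`, `φ`, `ψ` by Taylor polynomials at `t_n` leads to an
identity that telescopes at each pole and closes by the order conditions (`resolv_pow_add_sum`,
`evalOp_add_stepSum`). What remains are Taylor remainders and the Taylor coefficients of the
residual `y' - A y - φ + ψ'`. These coefficients involve `A_{h,0} y^{(m)}`, for which no bound
uniform in `h` is at hand; only the residual itself is known to be small. The way out is
`norm_resolv_pow_scaledDefect_le`: the coefficients of a polynomial are controlled by its values on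
`[0,1]`, these values differ from the residual by Taylor remainders, and the one remainder hit by `τ
A` is tamed by a resolvent, as `τ w A (I - τ w A)⁻¹ = (I - τ w A)⁻¹ - I`.

The resolvent powers are bounded uniformly in `h` and `τ` through the bounded semigroups
(`norm_expSemigroup_resolv_pow_le`), and power boundedness of `r(τ A_{h,0})` adds up the local
errors (`norm_le_of_stable_recursion`). The closed graph theorem bounds `∂ : W → Z` and `K(0) : Z →
W`, so that everything spatial is measured by `w` in `W`. -/

/-- The derivative of order `m` of `(1 - w z)^{-i}` at `z = 0`. -/
noncomputable def poleDeriv (w : ℂ) (i m : ℕ) : ℂ :=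
  iteratedDeriv m (fun z : ℂ => 1 / (1 - w * z) ^ i) 0

lemma contDiffAt_pole (w : ℂ) (i : ℕ) (n : WithTop ℕ∞) :
    ContDiffAt ℂ n (fun z : ℂ => 1 / (1 - w * z) ^ i) 0 := by
  refine ContDiffAt.div (by fun_prop) (by fun_prop) (by simp)

lemma poleDeriv_order_zero (w : ℂ) (i : ℕ) : poleDeriv w i 0 = 1 := by
  simp [poleDeriv]

lemma poleDeriv_exponent_zero (w : ℂ) (m : ℕ) :
    poleDeriv w 0 m = if m = 0 then 1 else 0 := by
  simp [poleDeriv, iteratedDeriv_const]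

/-- In Leibniz' rule only the term with a single derivative on `z` survives at the origin. For `m =
0` the truncated `m - 1` is harmless because of the factor `m`. -/
lemma iteratedDeriv_id_div_pole (w : ℂ) (i m : ℕ) :
    iteratedDeriv m (fun z : ℂ => z / (1 - w * z) ^ i) 0 = m * poleDeriv w i (m - 1) := by
  have h : (fun z : ℂ => z / (1 - w * z) ^ i) = (fun z => z) * (fun z => 1 / (1 - w * z) ^ i) := by
    funext z; simp [div_eq_mul_inv]
  rw [h, iteratedDeriv_mul (by fun_prop) (contDiffAt_pole w i _)]
  have hid : ∀ k, iteratedDeriv k (fun z : ℂ => z) 0 = if k = 1 then 1 else 0 := by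
    intro k
    rw [iteratedDeriv_fun_id_zero]
  simp only [hid]
  rcases m with _ | m
  · simp
  · rw [Finset.sum_eq_single 1]
    · simp [poleDeriv]
    · intro b _ hb; simp [hb]
    · simp

/-- Differentiates `w z (1 - w z)^{-(i+1)} = (1 - w z)^{-(i+1)} - (1 - w z)^{-i}`. This recursion in
`i` is the source of the telescoping in `resolv_pow_add_sum`. -/
lemma mul_poleDeriv (w : ℂ) (i m : ℕ) :
    w * (m * poleDeriv w (i + 1) (m - 1)) = poleDeriv w (i + 1) m - poleDeriv w i m := by
  have h0 : ∀ᶠ z : ℂ in 𝓝 0, 1 - w * z ≠ 0 := by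
    have : ContinuousAt (fun z : ℂ => 1 - w * z) 0 := by fun_prop
    exact this.eventually_ne (by simp)
  have h : (fun z : ℂ => w * (z / (1 - w * z) ^ (i + 1))) =ᶠ[𝓝 0]
      (fun z => 1 / (1 - w * z) ^ (i + 1)) - fun z => 1 / (1 - w * z) ^ i := by
    filter_upwards [h0] with z hz
    simp only [Pi.sub_apply]
    field_simp
    ring
  rw [← iteratedDeriv_id_div_pole, ← iteratedDeriv_const_mul_field, h.iteratedDeriv_eq,
    iteratedDeriv_sub (contDiffAt_pole _ _ _) (contDiffAt_pole _ _ _)]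
  rfl

/-- If the order of vanishing were some `n ≤ p`, then `h = z^n g` with `g 0 ≠ 0`; dividing the bound
by `z^n` off the origin forces `g → 0`, a contradiction. -/
lemma iteratedDeriv_eq_zero_of_isBigO {h : ℂ → ℂ} (hh : AnalyticAt ℂ h 0) {p : ℕ}
    (hO : h =O[𝓝 0] fun z : ℂ => z ^ (p + 1)) {m : ℕ} (hm : m ≤ p) : iteratedDeriv m h 0 = 0 := by
  have key : ((p + 1 : ℕ) : ℕ∞) ≤ analyticOrderAt h 0 := by
    by_contra hlt
    push Not at hlt
    obtain ⟨n, hn⟩ := ENat.ne_top_iff_exists.1 (ne_top_of_lt hlt)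
    rw [← hn] at hlt
    have hnp : n < p + 1 := by exact_mod_cast hlt
    obtain ⟨g, hg, hg0, hgz⟩ := (hh.analyticOrderAt_eq_natCast).1 hn.symm
    have h1 : (fun z : ℂ => z ^ n * g z) =O[𝓝[≠] 0] fun z => z ^ n * z ^ (p + 1 - n) := by
      have h2 := (hO.mono (nhdsWithin_le_nhds (s := {0}ᶜ)))
      refine (h2.congr' ?_ ?_)
      · filter_upwards [nhdsWithin_le_nhds hgz] with z hz
        simpa using hz
      · filter_upwards with z
        rw [← pow_add]; congr 1; omega
    obtain ⟨C, hC⟩ := h1.bound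
    have h3 : Tendsto (fun z : ℂ => C * ‖z ^ (p + 1 - n)‖) (𝓝[≠] 0) (𝓝 0) := by
      have : ContinuousAt (fun z : ℂ => C * ‖z ^ (p + 1 - n)‖) 0 := by fun_prop
      have h4 := this.tendsto
      have h5 : p + 1 - n ≠ 0 := by omega
      simp only [ne_eq, h5, not_false_eq_true, zero_pow, norm_zero, mul_zero] at h4
      exact h4.mono_left nhdsWithin_le_nhds
    have h4 : Tendsto g (𝓝[≠] 0) (𝓝 0) := by
      refine squeeze_zero_norm' ?_ h3
      filter_upwards [hC, self_mem_nhdsWithin] with z hz hz0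
      have hz0' : 0 < ‖z ^ n‖ := norm_pos_iff.2 (pow_ne_zero _ hz0)
      rw [norm_mul, norm_mul, mul_left_comm] at hz
      exact le_of_mul_le_mul_left hz hz0'
    exact hg0 (tendsto_nhds_unique (hg.continuousAt.tendsto.mono_left nhdsWithin_le_nhds) h4)
  exact (natCast_le_analyticOrderAt_iff_iteratedDeriv_eq_zero hh).1 key m (by omega)

namespace SimpleFractions

/-- The Taylor coefficients of an approximation of order `p` agree with those of `exp`. -/
lemma sum_poleDeriv (r : SimpleFractions) {p : ℕ} (hord : r.HasOrder p) {m : ℕ} (hm : m ≤ p) :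
    r.rInf * (if m = 0 then 1 else 0) +
      ∑ l : Fin r.k, ∑ j ∈ Finset.Icc 1 (r.m l), r.coeff l j * poleDeriv (r.w l) j m = 1 := by
  have hfun : r.eval = (fun _ => r.rInf) + ∑ l : Fin r.k, ∑ j ∈ Finset.Icc 1 (r.m l),
      (fun z => r.coeff l j * (1 / (1 - r.w l * z) ^ j)) := by
    funext z
    simp [eval, Finset.sum_apply, mul_comm, div_eq_mul_inv]
  have hterm : ∀ l : Fin r.k, ∀ j, ∀ n : WithTop ℕ∞,
      ContDiffAt ℂ n (fun z => r.coeff l j * (1 / (1 - r.w l * z) ^ j)) 0 :=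
    fun l j n => contDiffAt_const.mul (contDiffAt_pole _ _ _)
  have hsum : ∀ n : WithTop ℕ∞, ContDiffAt ℂ n (∑ l : Fin r.k, ∑ j ∈ Finset.Icc 1 (r.m l),
      (fun z => r.coeff l j * (1 / (1 - r.w l * z) ^ j))) 0 := by
    intro n
    have : (∑ l : Fin r.k, ∑ j ∈ Finset.Icc 1 (r.m l),
      (fun z => r.coeff l j * (1 / (1 - r.w l * z) ^ j))) = fun z => ∑ l : Fin r.k,
        ∑ j ∈ Finset.Icc 1 (r.m l), r.coeff l j * (1 / (1 - r.w l * z) ^ j) := by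
      funext z; simp [Finset.sum_apply]
    rw [this]
    exact ContDiffAt.sum fun l _ => ContDiffAt.sum fun j _ => hterm l j n
  have hcd : ∀ n : WithTop ℕ∞, ContDiffAt ℂ n r.eval 0 := by
    intro n
    rw [hfun]
    exact contDiffAt_const.add (hsum n)
  have hexp : ∀ n : WithTop ℕ∞, ContDiffAt ℂ n Complex.exp 0 := fun n =>
    Complex.contDiff_exp.contDiffAt
  have h0 : iteratedDeriv m (r.eval - Complex.exp) 0 = 0 :=
    iteratedDeriv_eq_zero_of_isBigO ((hcd _).sub (hexp _)).analyticAt hord hm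
  rw [iteratedDeriv_sub (hcd _) (hexp _), iteratedDeriv_eq_iterate (f := Complex.exp),
    Complex.iter_deriv_exp] at h0
  have h1 : iteratedDeriv m r.eval 0 = 1 := by
    simpa [sub_eq_zero] using h0
  rw [hfun, iteratedDeriv_add contDiffAt_const (hsum _), iteratedDeriv_const,
    iteratedDeriv_sum] at h1
  · refine Eq.trans ?_ h1
    congr 1
    · split_ifs <;> simp
    · refine Finset.sum_congr rfl fun l _ => ?_
      rw [iteratedDeriv_sum fun j _ => hterm l j _]
      refine Finset.sum_congr rfl fun j _ => ?_
      rw [iteratedDeriv_const_mul_field]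
      rfl
  · intro l _
    have : (∑ j ∈ Finset.Icc 1 (r.m l), (fun z => r.coeff l j * (1 / (1 - r.w l * z) ^ j))) =
        fun z => ∑ j ∈ Finset.Icc 1 (r.m l), r.coeff l j * (1 / (1 - r.w l * z) ^ j) := by
      funext z; simp [Finset.sum_apply]
    rw [this]
    exact ContDiffAt.sum fun j _ => hterm l j _

end SimpleFractions

/-! ### Vandermonde systems -/

/-- Distinct nodes make the Vandermonde determinant nonzero, so the matrix inverse in `nodeWeights`
is a genuine one. -/
lemma sum_pow_mul_nodeWeights {q : ℕ} {c : Fin q → ℝ} (hc : Function.Injective c) (R : ℂ → ℂ)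
    {j : ℕ} (hj : j < q) :
    ∑ k, (c k : ℂ) ^ j * nodeWeights c R k = iteratedDeriv j R 0 := by
  have hdet : IsUnit (Matrix.vandermonde (fun i => (c i : ℂ))).transpose.det := by
    rw [Matrix.det_transpose, isUnit_iff_ne_zero, Matrix.det_vandermonde_ne_zero_iff]
    exact Complex.ofReal_injective.comp hc
  have h := congrFun (show (Matrix.vandermonde (fun i => (c i : ℂ))).transpose.mulVec
      (nodeWeights c R) = fun j : Fin q => iteratedDeriv (j : ℕ) R 0 by
    unfold nodeWeights
    rw [ Matrix.mulVec_mulVec, Matrix.mul_nonsing_inv _ hdet, Matrix.one_mulVec]) ⟨j, hj⟩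
  simpa [Matrix.mulVec, dotProduct, Matrix.vandermonde] using h

section Interpolation

variable {V : Type*} [NormedAddCommGroup V] [NormedSpace ℂ V]

/-- Polynomials of degree less than `q` in the node variable are reproduced exactly. -/
lemma sum_nodeWeights_smul {q : ℕ} {c : Fin q → ℝ} (hc : Function.Injective c) (R : ℂ → ℂ)
    (a : ℕ → V) :
    ∑ k, nodeWeights c R k • ∑ m ∈ Finset.range q, (c k : ℂ) ^ m • a m =
      ∑ m ∈ Finset.range q, iteratedDeriv m R 0 • a m := by
  simp only [Finset.smul_sum, smul_smul]
  rw [Finset.sum_comm]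
  refine Finset.sum_congr rfl fun m hm => ?_
  rw [← Finset.sum_smul, ← sum_pow_mul_nodeWeights hc R (Finset.mem_range.1 hm)]
  simp only [mul_comm]

/-- The Vandermonde matrix of the equidistant nodes `k / (q + 1)`. -/
noncomputable def equiVandermonde (q : ℕ) : Matrix (Fin q) (Fin q) ℂ :=
  Matrix.vandermonde fun k : Fin q => ((k : ℕ) / (q + 1 : ℝ) : ℝ)

/-- A constant in the inverse inequality for polynomials of degree less than `q`. -/
noncomputable def inverseConst (q : ℕ) : ℝ := ∑ m, ∑ k, ‖(equiVandermonde q)⁻¹ m k‖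

lemma inverseConst_nonneg (q : ℕ) : 0 ≤ inverseConst q := by
  unfold inverseConst; positivity

/-- The coefficients are recovered from the values at `q` fixed points of `[0,1]` by the inverse
Vandermonde matrix, so the constant depends on `q` alone and not on the space `V`. -/
lemma norm_coeff_le_of_norm_poly_le {q : ℕ} (a : ℕ → V) {N : ℝ}
    (h : ∀ s ∈ Icc (0 : ℝ) 1, ‖∑ m ∈ Finset.range q, (s : ℂ) ^ m • a m‖ ≤ N) {m : ℕ} (hm : m < q) :
    ‖a m‖ ≤ inverseConst q * N := by
  have hq : (0 : ℝ) < q + 1 := by positivity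
  have hdet : IsUnit (equiVandermonde q).det := by
    rw [equiVandermonde, isUnit_iff_ne_zero, Matrix.det_vandermonde_ne_zero_iff]
    intro i j hij
    simp only [Complex.ofReal_inj] at hij
    rw [div_left_inj' hq.ne'] at hij
    exact Fin.ext (by exact_mod_cast hij)
  have hrep : a m = ∑ k, (equiVandermonde q)⁻¹ ⟨m, hm⟩ k •
      ∑ j ∈ Finset.range q, (((k : ℕ) / (q + 1 : ℝ) : ℝ) : ℂ) ^ j • a j := by
    have h1 : ∀ j : Fin q, ∑ k, (equiVandermonde q)⁻¹ ⟨m, hm⟩ k * equiVandermonde q k j =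
        if (⟨m, hm⟩ : Fin q) = j then 1 else 0 := by
      intro j
      rw [← Matrix.mul_apply, Matrix.nonsing_inv_mul _ hdet, Matrix.one_apply]
    calc a m = ∑ j : Fin q, (if (⟨m, hm⟩ : Fin q) = j then (1 : ℂ) else 0) • a j := by
          simp [ite_smul]
      _ = ∑ j : Fin q, ∑ k, ((equiVandermonde q)⁻¹ ⟨m, hm⟩ k * equiVandermonde q k j) • a j := by
          refine Finset.sum_congr rfl fun j _ => ?_
          rw [← h1, Finset.sum_smul]
      _ = _ := by
          rw [Finset.sum_comm]
          refine Finset.sum_congr rfl fun k _ => ?_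
          rw [Finset.sum_range, Finset.smul_sum]
          refine Finset.sum_congr rfl fun j _ => ?_
          rw [smul_smul]
          rfl
  have hnode : ∀ k : Fin q, ((k : ℕ) / (q + 1 : ℝ) : ℝ) ∈ Icc (0 : ℝ) 1 := by
    intro k
    refine ⟨by positivity, (div_le_one hq).2 ?_⟩
    have : ((k : ℕ) : ℝ) < q := by exact_mod_cast k.2
    linarith
  have hN : 0 ≤ N := (norm_nonneg _).trans (h 0 (by simp))
  rw [hrep]
  calc _ ≤ ∑ k, ‖(equiVandermonde q)⁻¹ ⟨m, hm⟩ k‖ * N := by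
        refine (norm_sum_le _ _).trans (Finset.sum_le_sum fun k _ => ?_)
        rw [norm_smul]
        exact mul_le_mul_of_nonneg_left (h _ (hnode k)) (norm_nonneg _)
    _ = (∑ k, ‖(equiVandermonde q)⁻¹ ⟨m, hm⟩ k‖) * N := by rw [Finset.sum_mul]
    _ ≤ inverseConst q * N := by
        refine mul_le_mul_of_nonneg_right ?_ hN
        exact Finset.single_le_sum (f := fun m => ∑ k, ‖(equiVandermonde q)⁻¹ m k‖)
          (fun i _ => by positivity) (Finset.mem_univ _)

end Interpolation

/-! ### Taylor's formula on an interval -/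

section Taylor

variable {V : Type*} [NormedAddCommGroup V] [NormedSpace ℝ V]

/-- `F 0, F 1, …, F N` are the successive derivatives of `F 0` on `[0, T]`. -/
def IsJet (N : ℕ) (T : ℝ) (F : ℕ → ℝ → V) : Prop :=
  ∀ j < N, ∀ t ∈ Icc (0 : ℝ) T, HasDerivWithinAt (F j) (F (j + 1) t) (Icc 0 T) t

lemma IsJet.mono {N N' : ℕ} {T : ℝ} {F : ℕ → ℝ → V} (hF : IsJet N T F) (h : N' ≤ N) :
    IsJet N' T F := fun j hj => hF j (hj.trans_le h)

lemma IsJet.shift {N : ℕ} {T : ℝ} {F : ℕ → ℝ → V} (hF : IsJet (N + 1) T F) :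
    IsJet N T (fun j => F (j + 1)) := fun j hj => hF (j + 1) (by omega)

/-- The Taylor polynomial with `N` terms. -/
noncomputable def taylorSum (N : ℕ) (F : ℕ → ℝ → V) (a x : ℝ) : V :=
  ∑ m ∈ Finset.range N, ((x - a) ^ m / m.factorial) • F m a

lemma hasDerivAt_taylorSum (N : ℕ) (F : ℕ → ℝ → V) (a x : ℝ) :
    HasDerivAt (taylorSum (N + 1) F a) (taylorSum N (fun j => F (j + 1)) a x) x := by
  have hfun : taylorSum (N + 1) F a = fun x => ∑ m ∈ Finset.range N,
      ((x - a) ^ (m + 1) / (m + 1).factorial) • F (m + 1) a + F 0 a := by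
    funext x
    rw [taylorSum, Finset.sum_range_succ']
    simp
  rw [hfun]
  refine HasDerivAt.add_const _ (HasDerivAt.fun_sum fun m _ => ?_)
  refine HasDerivAt.smul_const ?_ _
  have h := (((hasDerivAt_id x).sub_const a).pow (m + 1)).div_const ((m + 1).factorial : ℝ)
  convert! h using 1
  rw [Nat.factorial_succ]
  have : (m.factorial : ℝ) ≠ 0 := by positivity
  have : (m + 1 : ℝ) ≠ 0 := by positivity
  push_cast
  simp only [id]
  field_simp

/-- Induction with the mean value inequality: the derivative of the remainder is the remainder of
the shifted jet. The factor `1/N!` is given up. Unordered intervals are used since nodes may lie on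
either side of `a`. -/
lemma norm_sub_taylorSum_le {N : ℕ} {T : ℝ} {F : ℕ → ℝ → V} (hF : IsJet N T F) {C : ℝ}
    (hC : ∀ t ∈ Icc (0 : ℝ) T, ‖F N t‖ ≤ C) {a x : ℝ} (ha : a ∈ Icc (0 : ℝ) T)
    (hx : x ∈ Icc (0 : ℝ) T) : ‖F 0 x - taylorSum N F a x‖ ≤ C * |x - a| ^ N := by
  induction N generalizing F x with
  | zero => simpa [taylorSum] using hC x hx
  | succ N ih =>
    have hC0 : 0 ≤ C := (norm_nonneg _).trans (hC a ha)
    have hsub : uIcc a x ⊆ Icc (0 : ℝ) T := uIcc_subset_Icc ha hx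
    have hder : ∀ t ∈ uIcc a x, HasDerivWithinAt (fun t => F 0 t - taylorSum (N + 1) F a t)
        (F 1 t - taylorSum N (fun j => F (j + 1)) a t) (uIcc a x) t := fun t ht =>
      ((hF 0 (by omega) t (hsub ht)).mono hsub).sub
        (hasDerivAt_taylorSum N F a t).hasDerivWithinAt
    have hbd : ∀ t ∈ uIcc a x, ‖F 1 t - taylorSum N (fun j => F (j + 1)) a t‖ ≤
        C * |x - a| ^ N := by
      intro t ht
      refine (ih hF.shift hC (hsub ht)).trans ?_
      gcongr C * ?_ ^ N
      exact abs_sub_left_of_mem_uIcc ht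
    have h := (convex_uIcc a x).norm_image_sub_le_of_norm_hasDerivWithin_le hder hbd
      left_mem_uIcc right_mem_uIcc
    have h0 : taylorSum (N + 1) F a a = F 0 a := by
      rw [taylorSum, Finset.sum_range_succ']
      simp
    rw [h0, sub_self, sub_zero, Real.norm_eq_abs] at h
    rw [pow_succ, ← mul_assoc]
    exact h

end Taylor

/-! ### Resolvent bounds for bounded semigroups -/

section Resolvent

variable {V : Type*} [NormedAddCommGroup V] [NormedSpace ℂ V]

lemma expSemigroup_zero (A : V →L[ℂ] V) : expSemigroup A 0 = 1 := by
  simp [expSemigroup, NormedSpace.exp_zero]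

/-- Replaces `1 ≤ M`, which can fail when `V` is the zero space. -/
lemma norm_le_mul_of_expSemigroup {A : V →L[ℂ] V} {M : ℝ}
    (hM : ∀ t : ℝ, 0 ≤ t → ‖expSemigroup A t‖ ≤ M) (x : V) : ‖x‖ ≤ M * ‖x‖ := by
  have h := (expSemigroup A 0).le_of_opNorm_le (hM 0 le_rfl) x
  simpa [expSemigroup_zero] using h

variable [CompleteSpace V]

lemma hasDerivAt_expSemigroup (A : V →L[ℂ] V) (t : ℝ) :
    HasDerivAt (expSemigroup A) (expSemigroup A t * A) t := by
  have h := (hasDerivAt_exp_smul_const A (t : ℂ)).scomp t Complex.ofRealCLM.hasDerivAt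
  rw [Complex.ofRealCLM_apply, Complex.ofReal_one, one_smul] at h
  exact h

/-- The Laplace representation of the resolvent, without an improper integral: `e^{-μ s} S(t+s) x`
has derivative `-e^{-μ s} S(t+s) z` in `s` and tends to `0`. Bounding whole orbits loses no factor
`M`; `M` serves only to make the limit vanish. -/
lemma norm_expSemigroup_le_of_resolvent {A : V →L[ℂ] V} {μ : ℂ} (hμ : 0 < μ.re) {M Z : ℝ}
    (hM : ∀ t : ℝ, 0 ≤ t → ‖expSemigroup A t‖ ≤ M) {x z : V} (hx : μ • x - A x = z)
    (hz : ∀ t : ℝ, 0 ≤ t → ‖expSemigroup A t z‖ ≤ Z) {t : ℝ} (ht : 0 ≤ t) :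
    ‖expSemigroup A t x‖ ≤ Z / μ.re := by
  have hZ : 0 ≤ Z := (norm_nonneg _).trans (hz 0 le_rfl)
  set u : ℝ → V := fun s : ℝ => Complex.exp (-μ * (s : ℂ)) • expSemigroup A (t + s) x with hu
  have hder : ∀ s : ℝ, HasDerivAt u (-(Complex.exp (-μ * s) • expSemigroup A (t + s) z)) s := by
    intro s
    have h1 : HasDerivAt (fun s : ℝ => Complex.exp (-μ * s)) (Complex.exp (-μ * (s : ℂ)) * -μ) s := by
      have h := ((hasDerivAt_id (s : ℂ)).const_mul (-μ)).cexp.comp_ofReal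
      simpa using h
    have h2 : HasDerivAt (fun s : ℝ => expSemigroup A (t + s) x)
        ((expSemigroup A (t + s) * A) x) s := by
      exact ((ContinuousLinearMap.apply ℂ V x).restrictScalars ℝ).hasFDerivAt.comp_hasDerivAt s
        ((hasDerivAt_expSemigroup A (t + s)).comp_const_add t s)
    refine (h1.smul h2).congr_deriv ?_
    rw [← hx, map_sub, map_smul, mul_apply_eq_comp]
    module
  have hnexp : ∀ s : ℝ, ‖Complex.exp (-μ * s)‖ = Real.exp (-μ.re * s) := by
    intro s; rw [Complex.norm_exp]; simp
  have hbd : ∀ s : ℝ, 0 ≤ s → ‖u s - u 0‖ ≤ Z / μ.re * (1 - Real.exp (-μ.re * s)) := by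
    intro s hs
    have hB : ∀ s, HasDerivAt (fun s : ℝ => Z / μ.re * (1 - Real.exp (-μ.re * s)))
        (Z * Real.exp (-μ.re * s)) s := by
      intro s
      have h := (((((hasDerivAt_id s).const_mul (-μ.re)).exp).const_sub 1).const_mul (Z / μ.re))
      refine h.congr_deriv ?_
      simp only [id]
      field_simp
    -- The comparison function is the primitive of `Z e^{-Re μ s}` that vanishes at `0`.
    refine image_norm_le_of_norm_deriv_right_le_deriv_boundary (a := 0) (b := s)
      (f := fun s => u s - u 0) (f' := fun s => -(Complex.exp (-μ * s) • expSemigroup A (t + s) z))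
      (B' := fun s => Z * Real.exp (-μ.re * s)) ?_ ?_ ?_ hB ?_ ⟨hs, le_rfl⟩
    · exact fun s _ => ((hder s).sub_const _).continuousAt.continuousWithinAt
    · exact fun s _ => ((hder s).sub_const _).hasDerivWithinAt
    · simp
    · intro s hs
      rw [norm_neg, norm_smul, hnexp, mul_comm]
      exact mul_le_mul_of_nonneg_right (hz _ (add_nonneg ht hs.1)) (Real.exp_pos _).le
  have hle : ∀ s : ℝ, 0 ≤ s →
      ‖expSemigroup A t x‖ ≤ Z / μ.re + Real.exp (-μ.re * s) * (M * ‖x‖) := by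
    intro s hs
    have h0 : u 0 = expSemigroup A t x := by simp [hu]
    have h1 : ‖u s‖ ≤ Real.exp (-μ.re * s) * (M * ‖x‖) := by
      rw [hu, norm_smul, hnexp]
      gcongr
      exact (expSemigroup A (t + s)).le_of_opNorm_le (hM _ (add_nonneg ht hs)) x
    have h2 : ‖u 0‖ ≤ ‖u s‖ + ‖u s - u 0‖ := by
      have := norm_sub_le (u s) (u s - u 0)
      simpa using this
    have h3 : Z / μ.re * (1 - Real.exp (-μ.re * s)) ≤ Z / μ.re :=
      mul_le_of_le_one_right (by positivity) (by linarith [Real.exp_pos (-μ.re * s)])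
    rw [← h0]
    linarith [hbd s hs]
  have hlim : Tendsto (fun s : ℝ => Z / μ.re + Real.exp (-μ.re * s) * (M * ‖x‖)) atTop
      (𝓝 (Z / μ.re + 0 * (M * ‖x‖))) := by
    refine tendsto_const_nhds.add (Tendsto.mul_const _ ?_)
    refine Real.tendsto_exp_atBot.comp ?_
    exact tendsto_id.const_mul_atTop_of_neg (neg_lt_zero.2 hμ)
  rw [zero_mul, add_zero] at hlim
  exact ge_of_tendsto hlim (by filter_upwards [eventually_ge_atTop 0] with s hs using hle s hs)

/-- Take `μ = 1/(τ w)` in the resolvent estimate; `|μ| / Re μ = |w| / Re w`, so `τ` drops out. -/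
lemma norm_expSemigroup_le_of_sub_smul {A : V →L[ℂ] V} {w : ℂ} (hw : 0 < w.re) {τ : ℝ}
    (hτ : 0 < τ) {M Z : ℝ} (hM : ∀ t : ℝ, 0 ≤ t → ‖expSemigroup A t‖ ≤ M) {x z : V}
    (hx : x - ((τ : ℂ) * w) • A x = z) (hz : ∀ t : ℝ, 0 ≤ t → ‖expSemigroup A t z‖ ≤ Z)
    {t : ℝ} (ht : 0 ≤ t) : ‖expSemigroup A t x‖ ≤ ‖w‖ / w.re * Z := by
  have hw0 : w ≠ 0 := by rintro rfl; simp at hw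
  have hτ0 : (τ : ℂ) ≠ 0 := by exact_mod_cast hτ.ne'
  have hn : 0 < ‖w‖ := norm_pos_iff.2 hw0
  set μ : ℂ := ((τ : ℂ) * w)⁻¹ with hμdef
  have hre : μ.re = w.re / (τ * ‖w‖ ^ 2) := by
    rw [hμdef, Complex.inv_re, Complex.normSq_eq_norm_sq]
    simp [abs_of_pos hτ]
    field_simp
  have hnorm : ‖μ‖ = (τ * ‖w‖)⁻¹ := by simp [hμdef, abs_of_pos hτ, mul_comm]
  have hμ : 0 < μ.re := by rw [hre]; positivity
  have hx' : μ • x - A x = μ • z := by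
    rw [← hx, smul_sub, smul_smul, inv_mul_cancel₀ (mul_ne_zero hτ0 hw0), one_smul]
  have h := norm_expSemigroup_le_of_resolvent hμ hM hx' (Z := ‖μ‖ * Z)
    (fun s hs => by rw [map_smul, norm_smul]; exact mul_le_mul_of_nonneg_left (hz s hs)
                      (norm_nonneg _)) ht
  refine h.trans (le_of_eq ?_)
  rw [hre, hnorm]
  field_simp

variable [FiniteDimensional ℂ V]

/-- The estimate with right-hand side `0` gives injectivity, which suffices in finite dimension. It
ensures that `Ring.inverse` is a true inverse. -/
lemma isUnit_one_sub_smul {A : V →L[ℂ] V} {w : ℂ} (hw : 0 < w.re) {τ : ℝ}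
    (hτ : 0 < τ) {M : ℝ} (hM : ∀ t : ℝ, 0 ≤ t → ‖expSemigroup A t‖ ≤ M) :
    IsUnit (1 - ((τ : ℂ) * w) • A) := by
  have hinj : Function.Injective (1 - ((τ : ℂ) * w) • A : V →L[ℂ] V) := by
    rw [injective_iff_map_eq_zero]
    intro x hx
    have h := norm_expSemigroup_le_of_sub_smul hw hτ hM (x := x) (z := 0) (Z := 0)
      (by simpa using hx) (by simp) le_rfl
    rw [mul_zero, expSemigroup_zero] at h
    simpa using h
  rw [ContinuousLinearMap.isUnit_iff_bijective]
  exact ⟨hinj, (LinearMap.injective_iff_surjective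
    (f := ((1 - ((τ : ℂ) * w) • A : V →L[ℂ] V) : V →ₗ[ℂ] V))).1 hinj⟩

namespace SimpleFractions

variable (r : SimpleFractions) {A : V →L[ℂ] V} {τ M : ℝ}

lemma resolv_apply_sub (hτ : 0 < τ) (hM : ∀ t : ℝ, 0 ≤ t → ‖expSemigroup A t‖ ≤ M)
    (l : Fin r.k) (x : V) :
    ((τ : ℂ) * r.w l) • r.resolv τ A l (A x) = r.resolv τ A l x - x := by
  have h := congrArg (fun B : V →L[ℂ] V => B x)
    (Ring.inverse_mul_cancel _ (isUnit_one_sub_smul (r.w_re_pos l) hτ hM))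
  simp only [mul_apply_eq_comp, sub_apply,
    one_apply_eq_self, smul_apply, map_sub, map_smul] at h
  rw [resolv, eq_sub_iff_add_eq']
  exact (sub_eq_iff_eq_add.1 h).symm

/-- Estimating the orbit, that is, working in the norm `sup_t ‖S(t) x‖`, lets the induction run with
`M` to the first power instead of `M^i`. -/
lemma norm_expSemigroup_resolv_pow_le (hτ : 0 < τ)
    (hM : ∀ t : ℝ, 0 ≤ t → ‖expSemigroup A t‖ ≤ M) (l : Fin r.k) (i : ℕ) (x : V) {t : ℝ}
    (ht : 0 ≤ t) :
    ‖expSemigroup A t ((r.resolv τ A l ^ i) x)‖ ≤ (‖r.w l‖ / (r.w l).re) ^ i * (M * ‖x‖) := by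
  induction i generalizing t with
  | zero => simpa using (expSemigroup A t).le_of_opNorm_le (hM t ht) x
  | succ i ih =>
    rw [pow_succ', pow_succ' (‖r.w l‖ / (r.w l).re), mul_assoc]
    refine norm_expSemigroup_le_of_sub_smul (r.w_re_pos l) hτ hM
      (z := (r.resolv τ A l ^ i) x) ?_ (fun t ht => ih ht) ht
    have h := congrArg (fun B : V →L[ℂ] V => B ((r.resolv τ A l ^ i) x))
      (Ring.mul_inverse_cancel _ (isUnit_one_sub_smul (r.w_re_pos l) hτ hM))
    simpa [resolv] using h

/-- A bound for the ratios `(|w_l| / Re w_l)^i` with `i ≤ m_l`. -/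
noncomputable def angleConst : ℝ :=
  ∑ l : Fin r.k, ∑ i ∈ Finset.range (r.m l + 1), (‖r.w l‖ / (r.w l).re) ^ i

lemma angle_nonneg (l : Fin r.k) : 0 ≤ ‖r.w l‖ / (r.w l).re :=
  div_nonneg (norm_nonneg _) (r.w_re_pos l).le

lemma angleConst_nonneg : 0 ≤ r.angleConst :=
  Finset.sum_nonneg fun l _ => Finset.sum_nonneg fun i _ => pow_nonneg (r.angle_nonneg l) i

lemma norm_resolv_pow_le (hτ : 0 < τ) (hM : ∀ t : ℝ, 0 ≤ t → ‖expSemigroup A t‖ ≤ M)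
    {l : Fin r.k} {i : ℕ} (hi : i ≤ r.m l) (x : V) :
    ‖(r.resolv τ A l ^ i) x‖ ≤ M * r.angleConst * ‖x‖ := by
  have h := r.norm_expSemigroup_resolv_pow_le hτ hM l i x le_rfl
  rw [expSemigroup_zero, one_apply_eq_self] at h
  have hM0 : 0 ≤ M := (norm_nonneg _).trans (hM 0 le_rfl)
  have h1 : (‖r.w l‖ / (r.w l).re) ^ i ≤ r.angleConst := by
    refine le_trans ?_ (Finset.single_le_sum
      (f := fun l => ∑ i ∈ Finset.range (r.m l + 1), (‖r.w l‖ / (r.w l).re) ^ i)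
      (fun l _ => Finset.sum_nonneg fun i _ => pow_nonneg (r.angle_nonneg l) i)
      (Finset.mem_univ l))
    exact Finset.single_le_sum (f := fun i => (‖r.w l‖ / (r.w l).re) ^ i)
      (fun i _ => pow_nonneg (r.angle_nonneg l) i) (Finset.mem_range.2 (by omega))
  calc _ ≤ (‖r.w l‖ / (r.w l).re) ^ i * (M * ‖x‖) := h
    _ ≤ r.angleConst * (M * ‖x‖) := mul_le_mul_of_nonneg_right h1 (by positivity)
    _ = _ := by ring

end SimpleFractions

end Resolvent

/-! ### The inhomogeneous part of one step -/

section Step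

variable {V : Type*} [NormedAddCommGroup V] [NormedSpace ℂ V]

/-- `∑_l ∑_j r_{lj} w_l ∑_{i=1}^j (I - τ w_l A)^{-(j-i+1)} x_{l,i}`. -/
noncomputable def stepSum (r : SimpleFractions) (τ : ℝ) (A : V →L[ℂ] V)
    (x : Fin r.k → ℕ → V) : V :=
  ∑ l : Fin r.k, ∑ j ∈ Finset.Icc 1 (r.m l), (r.coeff l j * r.w l) •
    ∑ i ∈ Finset.Icc 1 j, ((r.resolv τ A l) ^ (j + 1 - i)) (x l i)

lemma stepSum_sub (r : SimpleFractions) (τ : ℝ) (A : V →L[ℂ] V) (x y : Fin r.k → ℕ → V) :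
    stepSum r τ A (fun l i => x l i - y l i) = stepSum r τ A x - stepSum r τ A y := by
  simp only [stepSum, map_sub, Finset.sum_sub_distrib, smul_sub]

lemma stepSum_smul (r : SimpleFractions) (τ : ℝ) (A : V →L[ℂ] V) (a : ℂ) (x : Fin r.k → ℕ → V) :
    stepSum r τ A (fun l i => a • x l i) = a • stepSum r τ A x := by
  simp only [stepSum, map_smul, Finset.smul_sum, smul_comm a]

/-- The sum of the moduli of the weights in `stepSum`. -/
noncomputable def SimpleFractions.stepWeight (r : SimpleFractions) : ℝ :=
  ∑ l : Fin r.k, ∑ j ∈ Finset.Icc 1 (r.m l), ‖r.coeff l j * r.w l‖ * ∑ _i ∈ Finset.Icc 1 j, (1 : ℝ)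

lemma SimpleFractions.stepWeight_nonneg (r : SimpleFractions) : 0 ≤ r.stepWeight := by
  unfold SimpleFractions.stepWeight; positivity

/-- Since `1 ≤ j + 1 - i ≤ j`, each summand carries at least one resolvent. The exponent `0` is
excluded on purpose: the spare resolvent later absorbs a factor `τ A`. -/
lemma norm_stepSum_le (r : SimpleFractions) (τ : ℝ) (A : V →L[ℂ] V) (x : Fin r.k → ℕ → V) {N : ℝ}
    (h : ∀ l, ∀ i ∈ Finset.Icc 1 (r.m l), ∀ j ∈ Finset.Icc 1 (r.m l),
      ‖(r.resolv τ A l ^ j) (x l i)‖ ≤ N) : ‖stepSum r τ A x‖ ≤ r.stepWeight * N := by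
  rw [stepSum, SimpleFractions.stepWeight, Finset.sum_mul]
  refine (norm_sum_le _ _).trans (Finset.sum_le_sum fun l _ => ?_)
  rw [Finset.sum_mul]
  refine (norm_sum_le _ _).trans (Finset.sum_le_sum fun j hj => ?_)
  rw [norm_smul, mul_assoc, Finset.sum_mul]
  refine mul_le_mul_of_nonneg_left ?_ (norm_nonneg _)
  refine (norm_sum_le _ _).trans (Finset.sum_le_sum fun i hi => ?_)
  rw [one_mul]
  simp only [Finset.mem_Icc] at hi hj
  exact h l i (Finset.mem_Icc.2 ⟨hi.1, hi.2.trans hj.2⟩) _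
    (Finset.mem_Icc.2 ⟨by omega, by omega⟩)

lemma stepE_eq_stepSum (r : SimpleFractions) (τ : ℝ) (A : V →L[ℂ] V) {q : ℕ} (c : Fin q → ℝ)
    (t : ℝ) (f : ℝ → V) : stepE r τ A c t f =
      stepSum r τ A (fun l i => ∑ k, gammaW r c l i k • f (t + τ * c k)) := rfl

lemma stepF_eq_stepSum {U : Type*} [NormedAddCommGroup U] [NormedSpace ℂ U] (r : SimpleFractions)
    (τ : ℝ) (A : V →L[ℂ] V) (K : U →L[ℂ] V) {q : ℕ} (d : Fin q → ℝ)
    (t : ℝ) (g : ℝ → U) : stepF r τ A K d t g =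
      stepSum r τ A (fun l i => ∑ k, etaW r d l i k • K (g (t + τ * d k))) := by
  simp only [stepF, stepSum, map_sum, map_smul]

variable {r : SimpleFractions} {τ : ℝ} {A : V →L[ℂ] V}

/-- Telescoping identity for one pole, for a jet `q`. -/
lemma resolv_pow_add_sum {l : Fin r.k}
    (hJ : ∀ x, ((τ : ℂ) * r.w l) • r.resolv τ A l (A x) = r.resolv τ A l x - x)
    {p : ℕ} {q : ℕ → V} (hq : q (p + 1) = 0) (j : ℕ) :
    (r.resolv τ A l ^ j) (q 0) + r.w l • ∑ i ∈ Finset.Icc 1 j, (r.resolv τ A l ^ (j + 1 - i))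
      (∑ m ∈ Finset.range (p + 1), (poleDeriv (r.w l) i m / m.factorial) •
        (q (m + 1) - (τ : ℂ) • A (q m))) =
    ∑ m ∈ Finset.range (p + 1), (poleDeriv (r.w l) j m / m.factorial) • q m := by
  set G : ℕ → V := fun i =>
    ∑ m ∈ Finset.range (p + 1), (poleDeriv (r.w l) i m / m.factorial) • q m with hG
  set T : ℕ → V := fun i => ∑ m ∈ Finset.range (p + 1), (poleDeriv (r.w l) i m / m.factorial) •
        (q (m + 1) - (τ : ℂ) • A (q m)) with hT
  -- The top term vanishes by `hq`. The term of order zero drops out of the difference on the right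
  -- because `(1 - w z)^{-i}` equals `1` at the origin for every `i`; the rest is `mul_poleDeriv`.
  have hshift : ∀ i, r.w l • ∑ m ∈ Finset.range (p + 1),
      (poleDeriv (r.w l) (i + 1) m / m.factorial) • q (m + 1) = G (i + 1) - G i := by
    intro i
    rw [Finset.sum_range_succ, hq, smul_zero, add_zero, hG]
    simp only
    rw [← Finset.sum_sub_distrib, Finset.sum_range_succ']
    simp only [poleDeriv_order_zero, sub_self, add_zero, Finset.smul_sum]
    refine Finset.sum_congr rfl fun m _ => ?_
    rw [← sub_smul, ← sub_div, ← mul_poleDeriv, smul_smul]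
    congr 1
    have h1 : (m.factorial : ℂ) ≠ 0 := by exact_mod_cast m.factorial_ne_zero
    have h2 : (m + 1 : ℂ) ≠ 0 := by exact_mod_cast m.succ_ne_zero
    rw [Nat.factorial_succ]
    push_cast
    field_simp
  -- In short, `w T_{i+1} = (I - τ w A) G_{i+1} - G_i`. Applying the resolvent turns this into the
  -- recursion for `G` used in the induction on `j`.
  have hstep : ∀ i, r.w l • T (i + 1) = G (i + 1) - G i - ((τ : ℂ) * r.w l) • A (G (i + 1)) := by
    intro i
    rw [← hshift, hT, hG]
    simp only [smul_sub, Finset.sum_sub_distrib, map_sum, map_smul, Finset.smul_sum]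
    congr 1
    refine Finset.sum_congr rfl fun m _ => ?_
    simp only [smul_smul]
    ring_nf
  induction j with
  | zero =>
    rw [Finset.sum_range_succ']
    simp [poleDeriv_exponent_zero]
  | succ j ih =>
    change (r.resolv τ A l ^ (j + 1)) (q 0) + r.w l • ∑ i ∈ Finset.Icc 1 (j + 1),
      (r.resolv τ A l ^ (j + 1 + 1 - i)) (T i) = G (j + 1)
    change (r.resolv τ A l ^ j) (q 0) + r.w l • ∑ i ∈ Finset.Icc 1 j,
      (r.resolv τ A l ^ (j + 1 - i)) (T i) = G j at ih
    have hsum : ∑ i ∈ Finset.Icc 1 (j + 1), (r.resolv τ A l ^ (j + 1 + 1 - i)) (T i) =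
        r.resolv τ A l (∑ i ∈ Finset.Icc 1 j, (r.resolv τ A l ^ (j + 1 - i)) (T i)) +
          r.resolv τ A l (T (j + 1)) := by
      rw [Finset.sum_Icc_succ_top (by omega),
        map_sum (r.resolv τ A l) (fun i => (r.resolv τ A l ^ (j + 1 - i)) (T i)), show j + 1 + 1 - (j + 1) = 1 by omega,
        pow_one]
      refine congrArg (· + _) ?_
      · refine Finset.sum_congr rfl fun i hi => ?_
        have : j + 1 + 1 - i = (j + 1 - i) + 1 := by have := (Finset.mem_Icc.1 hi).2; omega
        rw [this, pow_succ']
        rfl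
    rw [hsum, pow_succ', mul_apply_eq_comp, smul_add, ← add_assoc, ← map_smul,
      ← map_add, ih, ← map_smul, hstep, map_sub, map_sub, map_smul, hJ]
    abel

/-- A step of an approximation of order `p` is exact for polynomials of degree `p`. -/
lemma evalOp_add_stepSum
    (hJ : ∀ l x, ((τ : ℂ) * r.w l) • r.resolv τ A l (A x) = r.resolv τ A l x - x)
    {p : ℕ} (hord : r.HasOrder p) {q : ℕ → V} (hq : q (p + 1) = 0) :
    r.evalOp τ A (q 0) + stepSum r τ A (fun l i =>
      ∑ m ∈ Finset.range (p + 1), (poleDeriv (r.w l) i m / m.factorial) •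
        (q (m + 1) - (τ : ℂ) • A (q m))) =
    ∑ m ∈ Finset.range (p + 1), (1 / m.factorial : ℂ) • q m := by
  have hR : ∑ m ∈ Finset.range (p + 1), (1 / m.factorial : ℂ) • q m = r.rInf • q 0 +
      ∑ l : Fin r.k, ∑ j ∈ Finset.Icc 1 (r.m l), r.coeff l j •
        ∑ m ∈ Finset.range (p + 1), (poleDeriv (r.w l) j m / m.factorial) • q m := by
    have h1 : r.rInf • q 0 = ∑ m ∈ Finset.range (p + 1),
        ((r.rInf * if m = 0 then 1 else 0) / m.factorial) • q m := by
      rw [Finset.sum_range_succ']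
      simp
    rw [h1]
    simp only [Finset.smul_sum]
    have h2 : ∀ l : Fin r.k, ∑ j ∈ Finset.Icc 1 (r.m l), ∑ m ∈ Finset.range (p + 1),
        r.coeff l j • (poleDeriv (r.w l) j m / m.factorial) • q m =
        ∑ m ∈ Finset.range (p + 1), ∑ j ∈ Finset.Icc 1 (r.m l),
          r.coeff l j • (poleDeriv (r.w l) j m / m.factorial) • q m := fun l => Finset.sum_comm
    rw [Finset.sum_congr rfl fun l _ => h2 l, Finset.sum_comm, ← Finset.sum_add_distrib]
    refine Finset.sum_congr rfl fun m hm => ?_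
    -- The order conditions enter here: the numerator `1` is expanded as the Taylor coefficient of
    -- `r`, multiplied by `m!`.
    refine (congrArg (fun z : ℂ => (z / m.factorial) • q m) (r.sum_poleDeriv hord
      (Nat.lt_succ_iff.1 (Finset.mem_range.1 hm))).symm).trans ?_
    rw [add_div, add_smul, Finset.sum_div, Finset.sum_smul]
    congr 1
    refine Finset.sum_congr rfl fun l _ => ?_
    rw [Finset.sum_div, Finset.sum_smul]
    refine Finset.sum_congr rfl fun j _ => ?_
    rw [smul_smul, mul_div_assoc]
  rw [hR, SimpleFractions.evalOp, stepSum]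
  simp only [add_apply, smul_apply,
    one_apply_eq_self, sum_apply]
  rw [add_assoc, ← Finset.sum_add_distrib]
  congr 1
  refine Finset.sum_congr rfl fun l _ => ?_
  rw [← Finset.sum_add_distrib]
  refine Finset.sum_congr rfl fun j _ => ?_
  rw [mul_smul, ← smul_add, resolv_pow_add_sum (hJ l) hq]

end Step

/-! ### The error of one step -/

section LocalError

variable {V : Type*} [NormedAddCommGroup V] [NormedSpace ℂ V]

lemma taylorSum_add_mul (N : ℕ) (F : ℕ → ℝ → V) (a τ s : ℝ) :
    taylorSum N F a (a + τ * s) =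
      ∑ m ∈ Finset.range N, (s : ℂ) ^ m • (((τ : ℂ) ^ m / m.factorial) • F m a) := by
  refine Finset.sum_congr rfl fun m _ => ?_
  rw [add_sub_cancel_left, ← Complex.coe_smul, smul_smul]
  congr 1
  push_cast
  ring

lemma sum_gammaW_taylorSum (r : SimpleFractions) {q : ℕ} {c : Fin q → ℝ}
    (hc : Function.Injective c) (l : Fin r.k) (i : ℕ) (F : ℕ → ℝ → V) (a τ : ℝ) :
    ∑ k, gammaW r c l i k • taylorSum q F a (a + τ * c k) =
      ∑ m ∈ Finset.range q, (poleDeriv (r.w l) i m / m.factorial) • ((τ : ℂ) ^ m • F m a) := by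
  simp only [taylorSum_add_mul]
  rw [gammaW, sum_nodeWeights_smul hc]
  refine Finset.sum_congr rfl fun m _ => ?_
  rw [smul_smul, smul_smul, poleDeriv]
  congr 1
  ring

/-- As `z (1 - w z)^{-i}` vanishes at `0`, the value `F 0 a` disappears and the remaining terms are
those `gammaW` produces for the derivative, times `τ`. Hence `d` needs one node more than `c`. -/
lemma sum_etaW_taylorSum (r : SimpleFractions) {p : ℕ} {d : Fin (p + 1) → ℝ}
    (hd : Function.Injective d) (l : Fin r.k) (i : ℕ) (F : ℕ → ℝ → V) (a τ : ℝ) :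
    ∑ k, etaW r d l i k • taylorSum (p + 1) F a (a + τ * d k) =
      ∑ m ∈ Finset.range p,
        (poleDeriv (r.w l) i m / m.factorial) • ((τ : ℂ) ^ (m + 1) • F (m + 1) a) := by
  simp only [taylorSum_add_mul]
  rw [etaW, sum_nodeWeights_smul hd, Finset.sum_range_succ']
  simp only [iteratedDeriv_id_div_pole, Nat.cast_zero, zero_mul, zero_smul, add_zero]
  refine Finset.sum_congr rfl fun m _ => ?_
  rw [smul_smul, smul_smul]
  congr 1
  have h1 : (m.factorial : ℂ) ≠ 0 := by exact_mod_cast m.factorial_ne_zero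
  have h2 : (m + 1 : ℂ) ≠ 0 := by exact_mod_cast m.succ_ne_zero
  rw [Nat.factorial_succ, Nat.add_sub_cancel]
  push_cast
  field_simp

/-- The first Vandermonde equation. It makes the boundary part of a step blind to constants, which
is where the factor `τ` in `norm_stepF_le` comes from. -/
lemma sum_etaW_eq_zero (r : SimpleFractions) {p : ℕ} {d : Fin (p + 1) → ℝ}
    (hd : Function.Injective d) (l : Fin r.k) (i : ℕ) : ∑ k, etaW r d l i k = 0 := by
  have h := sum_pow_mul_nodeWeights hd (fun z => z / (1 - r.w l * z) ^ i) (Nat.succ_pos p)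
  rw [iteratedDeriv_id_div_pole] at h
  simpa [etaW] using h

section Kappa

variable (r : SimpleFractions) (p : ℕ) (c : Fin p → ℝ) (d : Fin (p + 1) → ℝ)

lemma one_le_kappa : 1 ≤ kappa r p c d := by
  unfold kappa
  exact le_add_of_nonneg_right (by positivity)

lemma sum_le_kappa {l : Fin r.k} {i : ℕ} (hi : i ∈ Finset.Icc 1 (r.m l)) :
    ∑ k, ‖gammaW r c l i k‖ * |c k| ^ p +
      ∑ k, ‖etaW r d l i k‖ * (|d k| + |d k| ^ (p + 1)) ≤ kappa r p c d := by
  set a : Fin r.k → ℕ → ℝ := fun l i => ∑ k, ‖gammaW r c l i k‖ * |c k| ^ p +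
      ∑ k, ‖etaW r d l i k‖ * (|d k| + |d k| ^ (p + 1)) with ha
  have h0 : ∀ l i, 0 ≤ a l i := fun l i => by rw [ha]; positivity
  have h1 : a l i ≤ ∑ i ∈ Finset.Icc 1 (r.m l), a l i :=
    Finset.single_le_sum (fun i _ => h0 l i) hi
  have h2 : ∑ i ∈ Finset.Icc 1 (r.m l), a l i ≤ ∑ l, ∑ i ∈ Finset.Icc 1 (r.m l), a l i :=
    Finset.single_le_sum (f := fun l => ∑ i ∈ Finset.Icc 1 (r.m l), a l i)
      (fun l _ => Finset.sum_nonneg fun i _ => h0 l i) (Finset.mem_univ l)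
  change a l i ≤ 1 + ∑ l, ∑ i ∈ Finset.Icc 1 (r.m l), a l i
  linarith

lemma sum_gammaW_le_kappa {l : Fin r.k} {i : ℕ} (hi : i ∈ Finset.Icc 1 (r.m l)) :
    ∑ k, ‖gammaW r c l i k‖ * |c k| ^ p ≤ kappa r p c d :=
  (le_add_of_nonneg_right (by positivity)).trans (sum_le_kappa r p c d hi)

lemma sum_etaW_le_kappa {l : Fin r.k} {i : ℕ} (hi : i ∈ Finset.Icc 1 (r.m l)) :
    ∑ k, ‖etaW r d l i k‖ * (|d k| + |d k| ^ (p + 1)) ≤ kappa r p c d :=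
  (le_add_of_nonneg_left (by positivity)).trans (sum_le_kappa r p c d hi)

end Kappa

/-- The terms `τ^m y^{(m)}(a)` of order at most `p`. -/
noncomputable def scaledJet (p : ℕ) (τ a : ℝ) (y : ℕ → ℝ → V) (m : ℕ) : V :=
  if m ≤ p then (τ : ℂ) ^ m • y m a else 0

/-- The terms `τ^{m+1} (φ^{(m)}(a) - ψ^{(m+1)}(a))` of order less than `p`. -/
noncomputable def scaledForcing (p : ℕ) (τ a : ℝ) (φ ψ : ℕ → ℝ → V) (m : ℕ) : V :=
  if m < p then (τ : ℂ) ^ (m + 1) • (φ m a - ψ (m + 1) a) else 0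

/-- The defects of the Taylor polynomials of `y`, `φ`, `ψ` in `y' = A y + φ - ψ'`. -/
noncomputable def scaledDefect (p : ℕ) (τ a : ℝ) (A : V →L[ℂ] V) (y φ ψ : ℕ → ℝ → V) (m : ℕ) :
    V :=
  scaledJet p τ a y (m + 1) - (τ : ℂ) • A (scaledJet p τ a y m) - scaledForcing p τ a φ ψ m

/-- Identifies the polynomial whose coefficients are the defects: it is `τ` times the residual of
the Taylor polynomials at `a + τ s`, a quantity comparable with the residual of the curve. -/
lemma sum_scaledDefect (p : ℕ) (τ a s : ℝ) (A : V →L[ℂ] V) (y φ ψ : ℕ → ℝ → V) :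
    ∑ m ∈ Finset.range (p + 1),
      (s : ℂ) ^ m • ((1 / m.factorial : ℂ) • scaledDefect p τ a A y φ ψ m) =
    (τ : ℂ) • (taylorSum p (fun j => y (j + 1)) a (a + τ * s) -
      A (taylorSum (p + 1) y a (a + τ * s)) - taylorSum p φ a (a + τ * s) +
        taylorSum p (fun j => ψ (j + 1)) a (a + τ * s)) := by
  simp only [taylorSum_add_mul, scaledDefect, smul_sub, smul_add, Finset.sum_sub_distrib, map_sum]
  have h1 : ∑ m ∈ Finset.range (p + 1),
      (s : ℂ) ^ m • ((1 / m.factorial : ℂ) • scaledJet p τ a y (m + 1)) =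
      (τ : ℂ) • ∑ m ∈ Finset.range p, (s : ℂ) ^ m • (((τ : ℂ) ^ m / m.factorial) • y (m + 1) a) := by
    rw [Finset.sum_range_succ, scaledJet, if_neg (by omega), smul_zero, smul_zero, add_zero,
      Finset.smul_sum]
    refine Finset.sum_congr rfl fun m hm => ?_
    rw [scaledJet, if_pos (by have := Finset.mem_range.1 hm; omega)]
    simp only [smul_smul]
    congr 1
    ring
  have h2 : ∑ m ∈ Finset.range (p + 1),
      (s : ℂ) ^ m • ((1 / m.factorial : ℂ) • (τ : ℂ) • A (scaledJet p τ a y m)) =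
      (τ : ℂ) • ∑ m ∈ Finset.range (p + 1),
        A ((s : ℂ) ^ m • (((τ : ℂ) ^ m / m.factorial) • y m a)) := by
    rw [Finset.smul_sum]
    refine Finset.sum_congr rfl fun m hm => ?_
    rw [scaledJet, if_pos (by have := Finset.mem_range.1 hm; omega)]
    simp only [smul_smul, map_smul]
    congr 1
    ring
  have h3 : ∑ m ∈ Finset.range (p + 1),
      (s : ℂ) ^ m • ((1 / m.factorial : ℂ) • scaledForcing p τ a φ ψ m) =
      (τ : ℂ) • ∑ m ∈ Finset.range p, (s : ℂ) ^ m • (((τ : ℂ) ^ m / m.factorial) • φ m a) -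
      (τ : ℂ) • ∑ m ∈ Finset.range p,
        (s : ℂ) ^ m • (((τ : ℂ) ^ m / m.factorial) • ψ (m + 1) a) := by
    rw [Finset.sum_range_succ, scaledForcing, if_neg (by omega), smul_zero, smul_zero, add_zero,
      Finset.smul_sum, Finset.smul_sum, ← Finset.sum_sub_distrib]
    refine Finset.sum_congr rfl fun m hm => ?_
    rw [scaledForcing, if_pos (Finset.mem_range.1 hm)]
    simp only [smul_smul, smul_sub]
    congr 2 <;> ring
  rw [h1, h2, h3]
  abel

/-- Because the weights sum to zero, `θ` may be replaced by its increments from `a`, which are of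
size `N τ |d k|`; the summand `|d k|` in `kappa` is there for this purpose. -/
lemma norm_stepF_le [CompleteSpace V] [FiniteDimensional ℂ V] (r : SimpleFractions) {p : ℕ}
    {A : V →L[ℂ] V} {τ M : ℝ} (hτ : 0 < τ) (hM : ∀ t : ℝ, 0 ≤ t → ‖expSemigroup A t‖ ≤ M)
    (c : Fin p → ℝ) {d : Fin (p + 1) → ℝ} (hd : Function.Injective d) {θ : ℝ → V} {a N : ℝ}
    (hθ : ∀ k, ‖θ (a + τ * d k) - θ a‖ ≤ N * (τ * |d k|)) (hN : 0 ≤ N) :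
    ‖stepF r τ A 1 d a θ‖ ≤
      r.stepWeight * (M * r.angleConst) * (τ * (kappa r p c d * N)) := by
  have hM0 : 0 ≤ M := (norm_nonneg _).trans (hM 0 le_rfl)
  have hH : 0 ≤ M * r.angleConst := mul_nonneg hM0 r.angleConst_nonneg
  rw [stepF_eq_stepSum, mul_assoc]
  refine norm_stepSum_le r τ A _ fun l i hi j hj => ?_
  refine (r.norm_resolv_pow_le hτ hM (Finset.mem_Icc.1 hj).2 _).trans ?_
  refine mul_le_mul_of_nonneg_left ?_ hH
  have h1 : ∑ k, etaW r d l i k • (1 : V →L[ℂ] V) (θ (a + τ * d k)) =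
      ∑ k, etaW r d l i k • (θ (a + τ * d k) - θ a) := by
    simp only [one_apply_eq_self, smul_sub, Finset.sum_sub_distrib, ← Finset.sum_smul,
      sum_etaW_eq_zero r hd, zero_smul, sub_zero]
  rw [h1]
  calc _ ≤ ∑ k, ‖etaW r d l i k‖ * (|d k| + |d k| ^ (p + 1)) * (N * τ) := by
        refine (norm_sum_le _ _).trans (Finset.sum_le_sum fun k _ => ?_)
        rw [norm_smul, mul_assoc]
        refine mul_le_mul_of_nonneg_left ((hθ k).trans ?_) (norm_nonneg _)
        have : 0 ≤ |d k| ^ (p + 1) * (N * τ) := by positivity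
        linarith
    _ = (∑ k, ‖etaW r d l i k‖ * (|d k| + |d k| ^ (p + 1))) * (N * τ) := by rw [Finset.sum_mul]
    _ ≤ kappa r p c d * (N * τ) :=
        mul_le_mul_of_nonneg_right (sum_etaW_le_kappa r p c d hi) (by positivity)
    _ = τ * (kappa r p c d * N) := by ring

/-- A bound for the derivatives at the origin of `(1 - w_l z)^{-i}` of order at most `p`. -/
noncomputable def SimpleFractions.poleConst (r : SimpleFractions) (p : ℕ) : ℝ :=
  ∑ l : Fin r.k, ∑ i ∈ Finset.Icc 1 (r.m l), ∑ m ∈ Finset.range (p + 1), ‖poleDeriv (r.w l) i m‖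

lemma SimpleFractions.poleConst_nonneg (r : SimpleFractions) (p : ℕ) : 0 ≤ r.poleConst p := by
  unfold SimpleFractions.poleConst; positivity

lemma SimpleFractions.le_poleConst (r : SimpleFractions) (p : ℕ) {l : Fin r.k} {i : ℕ}
    (hi : i ∈ Finset.Icc 1 (r.m l)) :
    ∑ m ∈ Finset.range (p + 1), ‖poleDeriv (r.w l) i m‖ ≤ r.poleConst p := by
  refine le_trans ?_ (Finset.single_le_sum (f := fun l => ∑ i ∈ Finset.Icc 1 (r.m l),
    ∑ m ∈ Finset.range (p + 1), ‖poleDeriv (r.w l) i m‖) (fun l _ => by positivity)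
    (Finset.mem_univ l))
  exact Finset.single_le_sum (f := fun i => ∑ m ∈ Finset.range (p + 1), ‖poleDeriv (r.w l) i m‖)
    (fun l _ => by positivity) hi

/-- The sum of the moduli of the poles. -/
noncomputable def SimpleFractions.poleSum (r : SimpleFractions) : ℝ := ∑ l, ‖(r.w l)⁻¹‖

lemma SimpleFractions.poleSum_nonneg (r : SimpleFractions) : 0 ≤ r.poleSum := by
  unfold SimpleFractions.poleSum; positivity

/-- The constant in the bound for the error of one step. -/
noncomputable def SimpleFractions.localConst (r : SimpleFractions) (p : ℕ) : ℝ :=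
  1 + r.stepWeight * r.angleConst +
    r.stepWeight * (r.poleConst p * (inverseConst (p + 1) * (r.angleConst * (1 + 2 * r.poleSum))))

lemma SimpleFractions.localConst_nonneg (r : SimpleFractions) (p : ℕ) : 0 ≤ r.localConst p := by
  have := r.stepWeight_nonneg
  have := r.angleConst_nonneg
  have := r.poleConst_nonneg p
  have := r.poleSum_nonneg
  have := inverseConst_nonneg (p + 1)
  unfold SimpleFractions.localConst
  positivity

variable [CompleteSpace V] [FiniteDimensional ℂ V] {r : SimpleFractions} {p : ℕ}
  {A : V →L[ℂ] V} {τ M T a : ℝ} {y φ ψ : ℕ → ℝ → V} {Ny Nφ Nψ δ : ℝ}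

/-- Each coefficient contains `A` applied to a derivative of `y` and cannot be estimated directly.
The inverse inequality reduces the claim to the polynomial on `[0,1]`, which is the residual at one
point plus Taylor remainders, and so needs no time derivative of the residual. -/
lemma norm_resolv_pow_scaledDefect_le (hτ : 0 < τ)
    (hM : ∀ t : ℝ, 0 ≤ t → ‖expSemigroup A t‖ ≤ M) (ha : a ∈ Icc (0 : ℝ) T) (haT : a + τ ≤ T)
    (hy : IsJet (p + 1) T y) (hφ : IsJet p T φ) (hψ : IsJet (p + 1) T ψ)
    (hNy : ∀ t ∈ Icc (0 : ℝ) T, ‖y (p + 1) t‖ ≤ Ny) (hNφ : ∀ t ∈ Icc (0 : ℝ) T, ‖φ p t‖ ≤ Nφ)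
    (hNψ : ∀ t ∈ Icc (0 : ℝ) T, ‖ψ (p + 1) t‖ ≤ Nψ)
    (hδ : ∀ t ∈ Icc (0 : ℝ) T, ‖y 1 t - A (y 0 t) - φ 0 t + ψ 1 t‖ ≤ δ)
    {l : Fin r.k} {i : ℕ} (hi : i ∈ Finset.Icc 1 (r.m l)) {m : ℕ} (hm : m < p + 1) :
    ‖(1 / m.factorial : ℂ) • (r.resolv τ A l ^ i) (scaledDefect p τ a A y φ ψ m)‖ ≤
      inverseConst (p + 1) * (M * r.angleConst * (1 + 2 * r.poleSum) *
        (τ * (δ + τ ^ p * (Ny + Nφ + Nψ)))) := by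
  have hM0 : 0 ≤ M := (norm_nonneg _).trans (hM 0 le_rfl)
  set H := M * r.angleConst with hHdef
  have hH : 0 ≤ H := mul_nonneg hM0 r.angleConst_nonneg
  have hNy0 : 0 ≤ Ny := (norm_nonneg _).trans (hNy a ha)
  have hNφ0 : 0 ≤ Nφ := (norm_nonneg _).trans (hNφ a ha)
  have hNψ0 : 0 ≤ Nψ := (norm_nonneg _).trans (hNψ a ha)
  have hδ0 : 0 ≤ δ := (norm_nonneg _).trans (hδ a ha)
  have hW : ‖(r.w l)⁻¹‖ ≤ r.poleSum :=
    Finset.single_le_sum (f := fun l => ‖(r.w l)⁻¹‖) (fun _ _ => norm_nonneg _) (Finset.mem_univ l)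
  have hw0 : r.w l ≠ 0 := by intro h; have := r.w_re_pos l; simp [h] at this
  obtain ⟨hi1, hi2⟩ := Finset.mem_Icc.1 hi
  obtain ⟨j, rfl⟩ : ∃ j, i = j + 1 := ⟨i - 1, by omega⟩
  refine norm_coeff_le_of_norm_poly_le (q := p + 1)
    (a := fun m => (1 / m.factorial : ℂ) • (r.resolv τ A l ^ (j + 1)) (scaledDefect p τ a A y φ ψ m))
    (fun s hs => ?_) hm
  have hx : a + τ * s ∈ Icc (0 : ℝ) T :=
    ⟨add_nonneg ha.1 (mul_nonneg hτ.le hs.1),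
      (add_le_add_right (mul_le_of_le_one_right hτ.le hs.2) a).trans haT⟩
  have hxa : |a + τ * s - a| ≤ τ := by
    rw [add_sub_cancel_left, abs_of_nonneg (mul_nonneg hτ.le hs.1)]
    exact mul_le_of_le_one_right hτ.le hs.2
  have hpoly : ∑ m ∈ Finset.range (p + 1), (s : ℂ) ^ m • ((1 / m.factorial : ℂ) •
      (r.resolv τ A l ^ (j + 1)) (scaledDefect p τ a A y φ ψ m)) = (r.resolv τ A l ^ (j + 1))
      (∑ m ∈ Finset.range (p + 1),
        (s : ℂ) ^ m • ((1 / m.factorial : ℂ) • scaledDefect p τ a A y φ ψ m)) := by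
    simp only [map_sum, map_smul]
  rw [hpoly, sum_scaledDefect]
  set x := a + τ * s with hxdef
  set e₁ := y 1 x - taylorSum p (fun j => y (j + 1)) a x with he₁
  set e₂ := φ 0 x - taylorSum p φ a x with he₂
  set e₃ := ψ 1 x - taylorSum p (fun j => ψ (j + 1)) a x with he₃
  set ρ := y 0 x - taylorSum (p + 1) y a x with hρ
  have hpow : ∀ n, |x - a| ^ n ≤ τ ^ n := fun n => pow_le_pow_left₀ (abs_nonneg _) hxa n
  have h1 : ‖e₁‖ ≤ Ny * τ ^ p := (norm_sub_taylorSum_le hy.shift hNy ha hx).trans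
    (mul_le_mul_of_nonneg_left (hpow p) hNy0)
  have h2 : ‖e₂‖ ≤ Nφ * τ ^ p := (norm_sub_taylorSum_le hφ hNφ ha hx).trans
    (mul_le_mul_of_nonneg_left (hpow p) hNφ0)
  have h3 : ‖e₃‖ ≤ Nψ * τ ^ p := (norm_sub_taylorSum_le hψ.shift hNψ ha hx).trans
    (mul_le_mul_of_nonneg_left (hpow p) hNψ0)
  have h4 : ‖ρ‖ ≤ Ny * τ ^ (p + 1) := (norm_sub_taylorSum_le hy hNy ha hx).trans
    (mul_le_mul_of_nonneg_left (hpow (p + 1)) hNy0)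
  -- Everything except `τ A ρ` is small in norm by itself.
  have hsplit : (τ : ℂ) • (taylorSum p (fun j => y (j + 1)) a x - A (taylorSum (p + 1) y a x) -
      taylorSum p φ a x + taylorSum p (fun j => ψ (j + 1)) a x) =
      (τ : ℂ) • ((y 1 x - A (y 0 x) - φ 0 x + ψ 1 x) - e₁ + e₂ - e₃) + (τ : ℂ) • A ρ := by
    rw [he₁, he₂, he₃, hρ, map_sub, ← smul_add]
    congr 1
    abel
  -- One of the `j + 1` resolvents is spent on `τ A`, leaving a difference of bounded operators. The
  -- remaining power may be `0`, hence the exponent `0` in `angleConst`.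
  have hAρ : (r.resolv τ A l ^ (j + 1)) ((τ : ℂ) • A ρ) =
      (r.w l)⁻¹ • ((r.resolv τ A l ^ (j + 1)) ρ - (r.resolv τ A l ^ j) ρ) := by
    have hJ := r.resolv_apply_sub hτ hM l ρ
    have hJ' : (τ : ℂ) • r.resolv τ A l (A ρ) = (r.w l)⁻¹ • (r.resolv τ A l ρ - ρ) := by
      rw [← hJ, smul_smul]
      congr 1
      field_simp
    rw [pow_succ, mul_apply_eq_comp, map_smul, hJ', map_smul, map_sub, mul_apply_eq_comp]
  rw [hsplit, map_add, hAρ]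
  have hA1 : ‖(r.resolv τ A l ^ (j + 1))
      ((τ : ℂ) • ((y 1 x - A (y 0 x) - φ 0 x + ψ 1 x) - e₁ + e₂ - e₃))‖ ≤
      H * (τ * (δ + τ ^ p * (Ny + Nφ + Nψ))) := by
    refine (r.norm_resolv_pow_le hτ hM hi2 _).trans (mul_le_mul_of_nonneg_left ?_ hH)
    rw [norm_smul, Complex.norm_real, Real.norm_eq_abs, abs_of_pos hτ]
    refine mul_le_mul_of_nonneg_left ?_ hτ.le
    have n1 := norm_sub_le ((y 1 x - A (y 0 x) - φ 0 x + ψ 1 x) - e₁ + e₂) e₃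
    have n2 := norm_add_le ((y 1 x - A (y 0 x) - φ 0 x + ψ 1 x) - e₁) e₂
    have n3 := norm_sub_le (y 1 x - A (y 0 x) - φ 0 x + ψ 1 x) e₁
    have n4 := hδ x hx
    linarith
  have hA2 : ‖(r.w l)⁻¹ • ((r.resolv τ A l ^ (j + 1)) ρ - (r.resolv τ A l ^ j) ρ)‖ ≤
      r.poleSum * (2 * (H * (Ny * τ ^ (p + 1)))) := by
    rw [norm_smul]
    refine mul_le_mul hW ?_ (norm_nonneg _) r.poleSum_nonneg
    have n1 := (r.norm_resolv_pow_le hτ hM hi2 ρ).trans (mul_le_mul_of_nonneg_left h4 hH)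
    have n2 := (r.norm_resolv_pow_le hτ hM (l := l) (i := j) (by omega) ρ).trans
      (mul_le_mul_of_nonneg_left h4 hH)
    have n3 := norm_sub_le ((r.resolv τ A l ^ (j + 1)) ρ) ((r.resolv τ A l ^ j) ρ)
    linarith
  have hfin : Ny * τ ^ (p + 1) ≤ τ * (δ + τ ^ p * (Ny + Nφ + Nψ)) := by
    have : 0 ≤ τ * (δ + τ ^ p * (Nφ + Nψ)) := by positivity
    rw [pow_succ]
    linarith
  have hfin2 : r.poleSum * (2 * (H * (Ny * τ ^ (p + 1)))) ≤
      r.poleSum * (2 * (H * (τ * (δ + τ ^ p * (Ny + Nφ + Nψ))))) := by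
    have := r.poleSum_nonneg
    gcongr
  refine (norm_add_le _ _).trans ((add_le_add hA1 (hA2.trans hfin2)).trans (le_of_eq ?_))
  ring

/-- The error of one step of the RL method along a curve `y` that satisfies `y' = A y + φ - ψ'` up to
`δ`. -/
lemma norm_local_error_le (hord : r.HasOrder p) (hτ : 0 < τ)
    (hM : ∀ t : ℝ, 0 ≤ t → ‖expSemigroup A t‖ ≤ M) (ha : a ∈ Icc (0 : ℝ) T) (haT : a + τ ≤ T)
    {c : Fin p → ℝ} {d : Fin (p + 1) → ℝ} (hc : Function.Injective c) (hd : Function.Injective d)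
    (hcT : ∀ k, a + τ * c k ∈ Icc (0 : ℝ) T) (hdT : ∀ k, a + τ * d k ∈ Icc (0 : ℝ) T)
    (hy : IsJet (p + 1) T y) (hφ : IsJet p T φ) (hψ : IsJet (p + 1) T ψ)
    (hNy : ∀ t ∈ Icc (0 : ℝ) T, ‖y (p + 1) t‖ ≤ Ny) (hNφ : ∀ t ∈ Icc (0 : ℝ) T, ‖φ p t‖ ≤ Nφ)
    (hNψ : ∀ t ∈ Icc (0 : ℝ) T, ‖ψ (p + 1) t‖ ≤ Nψ)
    (hδ : ∀ t ∈ Icc (0 : ℝ) T, ‖y 1 t - A (y 0 t) - φ 0 t + ψ 1 t‖ ≤ δ) :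
    ‖y 0 (a + τ) - (r.evalOp τ A (y 0 a) + (τ : ℂ) • stepE r τ A c a (φ 0) -
      stepF r τ A 1 d a (ψ 0))‖ ≤
      M * r.localConst p * τ * (δ + τ ^ p * (Ny + kappa r p c d * (Nφ + Nψ))) := by
  have hM0 : 0 ≤ M := (norm_nonneg _).trans (hM 0 le_rfl)
  have hH : 0 ≤ M * r.angleConst := mul_nonneg hM0 r.angleConst_nonneg
  have hNy0 : 0 ≤ Ny := (norm_nonneg _).trans (hNy a ha)
  have hNφ0 : 0 ≤ Nφ := (norm_nonneg _).trans (hNφ a ha)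
  have hNψ0 : 0 ≤ Nψ := (norm_nonneg _).trans (hNψ a ha)
  have hδ0 : 0 ≤ δ := (norm_nonneg _).trans (hδ a ha)
  have hκ := one_le_kappa r p c d
  set κ := kappa r p c d with hκdef
  have hκ0 : 0 ≤ κ := zero_le_one.trans hκ
  set q := scaledJet p τ a y with hq
  have hq0 : q 0 = y 0 a := by simp [hq, scaledJet]
  have hqp : q (p + 1) = 0 := by simp [hq, scaledJet]
  have hexact := evalOp_add_stepSum (A := A) (fun l x => r.resolv_apply_sub hτ hM l x) hord hqp
  have htaylor : ∑ m ∈ Finset.range (p + 1), (1 / m.factorial : ℂ) • q m =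
      taylorSum (p + 1) y a (a + τ) := by
    have h := taylorSum_add_mul (p + 1) y a τ 1
    rw [mul_one] at h
    rw [h]
    refine Finset.sum_congr rfl fun m hm => ?_
    rw [hq, scaledJet, if_pos (by have := Finset.mem_range.1 hm; omega), smul_smul]
    simp only [Complex.ofReal_one, one_pow, one_smul]
    congr 1
    ring
  set X : Fin r.k → ℕ → V := fun l i => (τ : ℂ) • ∑ k, gammaW r c l i k • φ 0 (a + τ * c k) -
    ∑ k, etaW r d l i k • (1 : V →L[ℂ] V) (ψ 0 (a + τ * d k)) with hX
  have hEF : (τ : ℂ) • stepE r τ A c a (φ 0) - stepF r τ A 1 d a (ψ 0) = stepSum r τ A X := by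
    rw [stepE_eq_stepSum, stepF_eq_stepSum, ← stepSum_smul, ← stepSum_sub]
  set Rem : Fin r.k → ℕ → V := fun l i =>
    (τ : ℂ) • ∑ k, gammaW r c l i k • (φ 0 (a + τ * c k) - taylorSum p φ a (a + τ * c k)) -
    ∑ k, etaW r d l i k • (ψ 0 (a + τ * d k) - taylorSum (p + 1) ψ a (a + τ * d k)) with hRem
  set Df : Fin r.k → ℕ → V := fun l i => ∑ m ∈ Finset.range (p + 1),
    (poleDeriv (r.w l) i m / m.factorial) • scaledDefect p τ a A y φ ψ m with hDf
  have hXsplit : ∀ l i, X l i = Rem l i + ∑ m ∈ Finset.range (p + 1),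
      (poleDeriv (r.w l) i m / m.factorial) • scaledForcing p τ a φ ψ m := by
    intro l i
    have h1 : ∑ m ∈ Finset.range (p + 1),
        (poleDeriv (r.w l) i m / m.factorial) • scaledForcing p τ a φ ψ m =
        (τ : ℂ) • ∑ k, gammaW r c l i k • taylorSum p φ a (a + τ * c k) -
          ∑ k, etaW r d l i k • taylorSum (p + 1) ψ a (a + τ * d k) := by
      rw [sum_gammaW_taylorSum r hc, sum_etaW_taylorSum r hd, Finset.sum_range_succ,
        scaledForcing, if_neg (lt_irrefl p), smul_zero, add_zero, Finset.smul_sum,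
        ← Finset.sum_sub_distrib]
      refine Finset.sum_congr rfl fun m hm => ?_
      rw [scaledForcing, if_pos (Finset.mem_range.1 hm), smul_sub, smul_sub]
      congr 1
      simp only [smul_smul]
      congr 1
      ring
    rw [h1]
    simp only [hX, hRem, smul_sub, Finset.sum_sub_distrib, one_apply_eq_self]
    abel
  -- The data of the exact identity are those of the method, `X`, up to quadrature remainders `Rem`
  -- and residual coefficients `Df`.
  have hdecomp : (fun l i => ∑ m ∈ Finset.range (p + 1), (poleDeriv (r.w l) i m / m.factorial) •
      (q (m + 1) - (τ : ℂ) • A (q m))) = fun l i => Df l i - (Rem l i - X l i) := by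
    funext l i
    rw [hXsplit, hDf, sub_add_cancel_left, sub_neg_eq_add, ← Finset.sum_add_distrib]
    refine Finset.sum_congr rfl fun m _ => ?_
    rw [← smul_add, scaledDefect, sub_add_cancel]
  rw [hdecomp, stepSum_sub, stepSum_sub, htaylor, hq0] at hexact
  have hmain : y 0 (a + τ) - (r.evalOp τ A (y 0 a) + (τ : ℂ) • stepE r τ A c a (φ 0) -
      stepF r τ A 1 d a (ψ 0)) = (y 0 (a + τ) - taylorSum (p + 1) y a (a + τ)) +
      (stepSum r τ A Df - stepSum r τ A Rem) := by
    rw [add_sub_assoc, hEF, ← hexact]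
    abel
  -- A factor `M` is put in so that all three contributions share it.
  have b1 : ‖y 0 (a + τ) - taylorSum (p + 1) y a (a + τ)‖ ≤ M * (Ny * τ ^ (p + 1)) := by
    refine (norm_le_mul_of_expSemigroup hM _).trans (mul_le_mul_of_nonneg_left ?_ hM0)
    have h := norm_sub_taylorSum_le hy hNy ha (x := a + τ) ⟨add_nonneg ha.1 hτ.le, haT⟩
    rwa [add_sub_cancel_left, abs_of_pos hτ] at h
  have b2 : ‖stepSum r τ A Df‖ ≤ r.stepWeight * (r.poleConst p * (inverseConst (p + 1) *
      (M * r.angleConst * (1 + 2 * r.poleSum) * (τ * (δ + τ ^ p * (Ny + Nφ + Nψ)))))) := by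
    refine norm_stepSum_le r τ A _ fun l i hi j hj => ?_
    have hE : 0 ≤ inverseConst (p + 1) * (M * r.angleConst * (1 + 2 * r.poleSum) *
        (τ * (δ + τ ^ p * (Ny + Nφ + Nψ)))) := by
      have := inverseConst_nonneg (p + 1)
      have := r.poleSum_nonneg
      positivity
    refine le_trans ?_ (mul_le_mul_of_nonneg_right (r.le_poleConst p hi) hE)
    rw [hDf, map_sum, Finset.sum_mul]
    refine (norm_sum_le _ _).trans (Finset.sum_le_sum fun m hm => ?_)
    rw [map_smul, div_eq_mul_one_div, mul_smul, norm_smul]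
    exact mul_le_mul_of_nonneg_left (norm_resolv_pow_scaledDefect_le hτ hM ha haT hy hφ hψ
      hNy hNφ hNψ hδ hj (Finset.mem_range.1 hm)) (norm_nonneg _)
  have b3 : ‖stepSum r τ A Rem‖ ≤ r.stepWeight * (M * r.angleConst *
      (τ ^ (p + 1) * (κ * (Nφ + Nψ)))) := by
    refine norm_stepSum_le r τ A _ fun l i hi j hj => ?_
    refine (r.norm_resolv_pow_le hτ hM (Finset.mem_Icc.1 hj).2 _).trans ?_
    refine mul_le_mul_of_nonneg_left ?_ hH
    have e1 : ‖∑ k, gammaW r c l i k • (φ 0 (a + τ * c k) - taylorSum p φ a (a + τ * c k))‖ ≤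
        κ * (Nφ * τ ^ p) := by
      refine le_trans ?_ (mul_le_mul_of_nonneg_right (sum_gammaW_le_kappa r p c d hi)
        (by positivity))
      rw [Finset.sum_mul]
      refine (norm_sum_le _ _).trans (Finset.sum_le_sum fun k _ => ?_)
      rw [norm_smul, mul_assoc]
      refine mul_le_mul_of_nonneg_left ?_ (norm_nonneg _)
      refine (norm_sub_taylorSum_le hφ hNφ ha (hcT k)).trans (le_of_eq ?_)
      rw [add_sub_cancel_left, abs_mul, abs_of_pos hτ, mul_pow]
      ring
    have e2 : ‖∑ k, etaW r d l i k • (ψ 0 (a + τ * d k) - taylorSum (p + 1) ψ a (a + τ * d k))‖ ≤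
        κ * (Nψ * τ ^ (p + 1)) := by
      refine le_trans ?_ (mul_le_mul_of_nonneg_right (sum_etaW_le_kappa r p c d hi)
        (by positivity))
      rw [Finset.sum_mul]
      refine (norm_sum_le _ _).trans (Finset.sum_le_sum fun k _ => ?_)
      rw [norm_smul, mul_assoc]
      refine mul_le_mul_of_nonneg_left ?_ (norm_nonneg _)
      refine (norm_sub_taylorSum_le hψ hNψ ha (hdT k)).trans ?_
      rw [add_sub_cancel_left, abs_mul, abs_of_pos hτ, mul_pow]
      have : 0 ≤ |d k| * (Nψ * τ ^ (p + 1)) := by positivity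
      linarith
    have e3 : ‖Rem l i‖ ≤ τ * (κ * (Nφ * τ ^ p)) + κ * (Nψ * τ ^ (p + 1)) := by
      refine (norm_sub_le _ _).trans (add_le_add ?_ e2)
      rw [norm_smul, Complex.norm_real, Real.norm_eq_abs, abs_of_pos hτ]
      exact mul_le_mul_of_nonneg_left e1 hτ.le
    refine e3.trans (le_of_eq ?_)
    ring
  rw [hmain]
  set N := τ * (δ + τ ^ p * (Ny + κ * (Nφ + Nψ))) with hN
  have hκN : Nφ + Nψ ≤ κ * (Nφ + Nψ) := le_mul_of_one_le_left (by positivity) hκ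
  have n1 : Ny * τ ^ (p + 1) ≤ N := by
    have : 0 ≤ τ * (δ + τ ^ p * (κ * (Nφ + Nψ))) := by positivity
    rw [hN, pow_succ]
    linarith
  have n2 : τ * (δ + τ ^ p * (Ny + Nφ + Nψ)) ≤ N := by
    rw [hN, add_assoc Ny]
    gcongr
  have n3 : τ ^ (p + 1) * (κ * (Nφ + Nψ)) ≤ N := by
    have : 0 ≤ τ * (δ + τ ^ p * Ny) := by positivity
    rw [hN, pow_succ]
    linarith
  have hw := r.stepWeight_nonneg
  have hi := inverseConst_nonneg (p + 1)
  have hp := r.poleConst_nonneg p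
  have hs := r.poleSum_nonneg
  calc _ ≤ M * N + (r.stepWeight * (r.poleConst p * (inverseConst (p + 1) *
      (M * r.angleConst * (1 + 2 * r.poleSum) * N))) + r.stepWeight * (M * r.angleConst * N)) := by
        refine (norm_add_le _ _).trans (add_le_add (b1.trans (by gcongr)) ?_)
        refine (norm_sub_le _ _).trans (add_le_add (b2.trans ?_) (b3.trans ?_)) <;> gcongr
    _ = M * r.localConst p * N := by
        rw [SimpleFractions.localConst]
        ring
    _ = _ := by rw [hN]; ring

end LocalError

/-! ### The stationary solution operator -/

section Stationary

open MeasureTheory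

variable {X : Type*} [NormedAddCommGroup X] [NormedSpace ℂ X]

namespace C0Semigroup

variable (T : C0Semigroup X) {M ω : ℝ}

lemma integrableOn (hω : ω < 0) (hT : ∀ t, 0 ≤ t → ‖T.S t‖ ≤ M * Real.exp (ω * t)) (x : X) :
    IntegrableOn (fun t => T.S t x) (Ioi 0) := by
  have hg : IntegrableOn (fun t => M * Real.exp (ω * t) * ‖x‖) (Ioi 0) :=
    ((integrableOn_exp_mul_Ioi hω 0).const_mul M).mul_const _
  refine hg.mono' (((T.strong_cont x).mono Ioi_subset_Ici_self).aestronglyMeasurable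
    measurableSet_Ioi) ?_
  filter_upwards [ae_restrict_mem measurableSet_Ioi] with t ht
  exact (T.S t).le_of_opNorm_le (hT t (mem_Ioi.1 ht).le) x

/-- The inverse of the negative generator of an exponentially stable semigroup. -/
noncomputable def negInverse (hω : ω < 0) (hT : ∀ t, 0 ≤ t → ‖T.S t‖ ≤ M * Real.exp (ω * t)) :
    X →L[ℂ] X :=
  LinearMap.mkContinuous
    { toFun := fun x => ∫ t in Ioi 0, T.S t x
      map_add' := fun x y =>
        (integral_congr_ae (Eventually.of_forall fun t => (T.S t).map_add x y)).trans
          (integral_add (T.integrableOn hω hT x) (T.integrableOn hω hT y))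
      map_smul' := fun a x =>
        (integral_congr_ae (Eventually.of_forall fun t => (T.S t).map_smul a x)).trans
          (integral_smul a _) }
    (∫ t in Ioi 0, M * Real.exp (ω * t))
    (fun x => by
      change ‖∫ t in Ioi 0, T.S t x‖ ≤ _
      rw [← integral_mul_const]
      refine norm_integral_le_of_norm_le
        (((integrableOn_exp_mul_Ioi hω 0).const_mul M).mul_const _) ?_
      filter_upwards [ae_restrict_mem measurableSet_Ioi] with t ht
      exact (T.S t).le_of_opNorm_le (hT t (mem_Ioi.1 ht).le) x)

/-- By the semigroup law and a translation, `S(h)` moves the lower limit of `∫₀^∞ S(t) x dt` to `h`,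
so the difference is `-∫₀^h S(t) x dt`; its quotient by `h` tends to `-x` by strong continuity at
`0`. -/
lemma tendsto_negInverse [CompleteSpace X] (hω : ω < 0) (hT : ∀ t, 0 ≤ t → ‖T.S t‖ ≤ M * Real.exp (ω * t)) (x : X) :
    Tendsto (fun t : ℝ => ((t⁻¹ : ℝ) : ℂ) • (T.S t (T.negInverse hω hT x) - T.negInverse hω hT x))
      (𝓝[>] 0) (𝓝 (-x)) := by
  have hint := T.integrableOn hω hT x
  have hval : ∀ h : ℝ, 0 < h → T.S h (T.negInverse hω hT x) - T.negInverse hω hT x =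
      -∫ t in (0 : ℝ)..h, T.S t x := by
    intro h hh
    have h1 : T.S h (∫ t in Ioi 0, T.S t x) = ∫ t in Ioi h, T.S t x := by
      rw [← ContinuousLinearMap.integral_comp_comm _ hint]
      have h2 := (measurePreserving_add_left volume h).setIntegral_preimage_emb
        (measurableEmbedding_addLeft h) (fun t => T.S t x) (Ioi h)
      rw [preimage_const_add_Ioi, sub_self] at h2
      rw [← h2]
      refine setIntegral_congr_fun measurableSet_Ioi fun t ht => ?_
      change T.S h (T.S t x) = T.S (h + t) x
      rw [T.map_add h t hh.le (mem_Ioi.1 ht).le]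
      rfl
    change T.S h (∫ t in Ioi 0, T.S t x) - ∫ t in Ioi 0, T.S t x = _
    rw [h1, ← intervalIntegral.integral_Ioi_sub_Ioi hint hh.le, neg_sub]
  have hder : HasDerivWithinAt (fun u => ∫ t in (0 : ℝ)..u, T.S t x) (T.S 0 x) (Ioi 0) 0 := by
    refine (intervalIntegral.integral_hasDerivWithinAt_right (s := Ici 0) (t := Ioi 0) (by simp)
      ?_ ?_).mono Ioi_subset_Ici_self
    · exact ⟨Ioi 0, self_mem_nhdsWithin, hint.aestronglyMeasurable⟩
    · exact ((T.strong_cont x) 0 self_mem_Ici).mono Ioi_subset_Ici_self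
  rw [hasDerivWithinAt_iff_tendsto_slope' (by simp), T.map_zero, one_apply_eq_self] at hder
  refine (hder.neg).congr' ?_
  filter_upwards [self_mem_nhdsWithin] with h hh
  rw [hval h hh, slope_def_module, intervalIntegral.integral_same, sub_zero, sub_zero, smul_neg,
    Complex.coe_smul]

end C0Semigroup

variable {Y : Type*} [NormedAddCommGroup Y] [NormedSpace ℂ Y]

/-- The extension is corrected inside `Ker ∂`: `E + (-A₀)⁻¹ A E` keeps the boundary value of `E`,
and `A` annihilates its range. This shows that the choice in `K0` is not the default `0`. -/
lemma BoundaryProblem.K0_spec [CompleteSpace X] (P : BoundaryProblem X Y) (v : Y) :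
    ∃ hv : P.K0 v ∈ P.A.domain, P.A ⟨P.K0 v, hv⟩ = 0 ∧ P.bd ⟨P.K0 v, hv⟩ = v := by
  have hex : ∃ K : Y →L[ℂ] X, ∀ v, ∃ hv : K v ∈ P.A.domain,
      P.A ⟨K v, hv⟩ = 0 ∧ P.bd ⟨K v, hv⟩ = v := by
    obtain ⟨T, hgen, M, ω, -, hω, hT⟩ := P.exists_semigroup
    obtain ⟨E, AE, hE⟩ := P.exists_extension
    refine ⟨E + (T.negInverse hω hT).comp AE, fun v => ?_⟩
    obtain ⟨hv, hbd, hA⟩ := hE v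
    obtain ⟨⟨hz1, hz2⟩, hz⟩ := (hgen _ _).2 (T.tendsto_negInverse hω hT (AE v))
    obtain ⟨z, hz0, hzeq⟩ := hz1
    have hAz : P.A z = -AE v :=
      (LinearPMap.domRestrict_apply (f := P.A) (y := z) hzeq.symm).symm.trans hz
    have hmem : (E + (T.negInverse hω hT).comp AE) v ∈ P.A.domain := by
      simpa using P.A.domain.add_mem hv hz2
    have hsum : (⟨_, hmem⟩ : P.A.domain) = ⟨E v, hv⟩ + z := by
      ext
      simpa using hzeq.symm
    refine ⟨hmem, ?_⟩
    rw [hsum, LinearMap.map_add, LinearPMap.map_add, hA, hAz, hbd, LinearMap.mem_ker.1 hz0]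
    simp
  unfold BoundaryProblem.K0
  rw [dif_pos hex]
  exact hex.choose_spec v

end Stationary

/-! ### Bounded operators between the consistency spaces -/

section ClosedGraph

/-- Closed graph theorem: a limit of lifts is a lift of the limit, since `ι` is continuous and
injective. -/
lemma exists_clm_lift {E F G : Type*} [NormedAddCommGroup E] [NormedSpace ℂ E] [CompleteSpace E]
    [NormedAddCommGroup F] [NormedSpace ℂ F] [NormedAddCommGroup G] [NormedSpace ℂ G]
    [CompleteSpace G] (T : E →L[ℂ] F) (ι : G →L[ℂ] F) (hι : Function.Injective ι)
    (h : ∀ x, ∃ y, ι y = T x) : ∃ L : E →L[ℂ] G, ∀ x, ι (L x) = T x := by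
  choose f hf using h
  let g : E →ₗ[ℂ] G :=
    { toFun := f
      map_add' := fun x y => hι (by simp [hf])
      map_smul' := fun a x => hι (by simp [hf]) }
  refine ⟨ContinuousLinearMap.ofSeqClosedGraph (g := g) fun u x y hu hy => ?_, hf⟩
  refine hι (tendsto_nhds_unique ((ι.continuous.tendsto y).comp hy) ?_)
  have h1 : ι ∘ g ∘ u = fun n => T (u n) := funext fun n => hf (u n)
  rw [h1, show ι (g x) = T x from hf x]
  exact (T.continuous.tendsto x).comp hu

variable {X Y W Z : Type*} [NormedAddCommGroup X] [NormedSpace ℂ X]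
  [NormedAddCommGroup Y] [NormedSpace ℂ Y]
  [NormedAddCommGroup W] [NormedSpace ℂ W] [CompleteSpace W]
  [NormedAddCommGroup Z] [NormedSpace ℂ Z] [CompleteSpace Z]
  {P : BoundaryProblem X Y} (S : ConsistencySpaces P W Z)

namespace ConsistencySpaces

-- The closed graph argument is run for the pair `[A, ∂]` on `W`, since `∂` alone is not assumed
-- closed.
omit [CompleteSpace Z] in
lemma exists_clm_boundary [CompleteSpace X] [CompleteSpace Y] :
    ∃ β : W →L[ℂ] Y, ∀ w, β w = P.bd (S.toDomain w) := by
  let g : W →ₗ[ℂ] X × Y := (P.A.toFun.comp S.toDomain).prod (P.bd.comp S.toDomain)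
  have hg : ∀ (u : ℕ → W) (x : W) (y : X × Y), Tendsto u atTop (𝓝 x) →
      Tendsto (g ∘ u) atTop (𝓝 y) → y = g x := by
    intro u x y hu hy
    have hmem : (S.incW x, y) ∈ {q : X × X × Y | ∃ x : P.A.domain, q = ((x : X), P.A x, P.bd x)} :=
      P.closed.mem_of_tendsto (((S.incW.continuous.tendsto x).comp hu).prodMk_nhds hy)
        (Eventually.of_forall fun n => ⟨S.toDomain (u n), rfl⟩)
    obtain ⟨z, hz⟩ := hmem
    have hz1 : S.toDomain x = z := Subtype.ext (congrArg Prod.fst hz)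
    rw [← hz1] at hz
    exact congrArg Prod.snd hz
  exact ⟨(ContinuousLinearMap.snd ℂ X Y).comp (ContinuousLinearMap.ofSeqClosedGraph hg),
    fun w => rfl⟩

lemma exists_clm_trace [CompleteSpace X] [CompleteSpace Y] :
    ∃ β : W →L[ℂ] Z, ∀ w, S.incZ (β w) = P.bd (S.toDomain w) := by
  obtain ⟨β, hβ⟩ := S.exists_clm_boundary
  obtain ⟨L, hL⟩ := exists_clm_lift β S.incZ S.incZ_injective fun w => by
    rw [hβ]; exact S.bd_mem w
  exact ⟨L, fun w => (hL w).trans (hβ w)⟩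

lemma exists_clm_stationary : ∃ k : Z →L[ℂ] W, ∀ z, S.incW (k z) = P.K0 (S.incZ z) := by
  obtain ⟨L, hL⟩ := exists_clm_lift (P.K0.comp S.incZ) S.incW S.incW_injective S.K0_mem
  exact ⟨L, hL⟩

end ConsistencySpaces

end ClosedGraph

/-! ### Jets of smooth functions on `[0, ∞)` -/

section Jets

lemma cNorm_nonneg {V : Type*} [NormedAddCommGroup V] [NormedSpace ℝ V] (m : ℕ) (T : ℝ)
    (f : ℝ → V) : 0 ≤ cNorm m T f :=
  Real.iSup_nonneg fun _ => Real.iSup_nonneg fun _ => norm_nonneg _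

/-- A real supremum dominates its members only if they are bounded; continuity on the compact
interval provides this. -/
lemma norm_iteratedDerivWithin_le_cNorm {V : Type*} [NormedAddCommGroup V] [NormedSpace ℝ V]
    {m j : ℕ} {T s : ℝ} {f : ℝ → V} (hf : ContDiffOn ℝ m f (Ici 0)) (hj : j ≤ m)
    (hs : s ∈ Icc (0 : ℝ) T) : ‖iteratedDerivWithin j f (Ici 0) s‖ ≤ cNorm m T f := by
  have hcont : ContinuousOn (fun s => ‖iteratedDerivWithin j f (Ici 0) s‖) (Icc 0 T) :=
    ((hf.continuousOn_iteratedDerivWithin (by exact_mod_cast hj) (uniqueDiffOn_Ici 0)).mono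
      Icc_subset_Ici_self).norm
  have hbdd : BddAbove (range fun s : Icc (0 : ℝ) T =>
      ‖iteratedDerivWithin j f (Ici 0) (s : ℝ)‖) := by
    have h := (isCompact_Icc.image_of_continuousOn hcont).bddAbove
    rwa [image_eq_range] at h
  have h1 := le_ciSup hbdd ⟨s, hs⟩
  have h2 := le_ciSup (f := fun j : Fin (m + 1) => ⨆ s : Icc (0 : ℝ) T,
    ‖iteratedDerivWithin (j : ℕ) f (Ici 0) (s : ℝ)‖) (Set.finite_range _).bddAbove
    ⟨j, Nat.lt_succ_of_le hj⟩
  exact h1.trans h2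

lemma isJet_iteratedDerivWithin {V : Type*} [NormedAddCommGroup V] [NormedSpace ℝ V]
    {m : ℕ} {f : ℝ → V} (hf : ContDiffOn ℝ m f (Ici 0)) (T : ℝ) :
    IsJet m T (fun j => iteratedDerivWithin j f (Ici 0)) := by
  intro j hj t ht
  have h := (hf.differentiableOn_iteratedDerivWithin (by exact_mod_cast hj)
    (uniqueDiffOn_Ici 0) t ht.1).hasDerivWithinAt
  rw [← iteratedDerivWithin_succ] at h
  exact h.mono Icc_subset_Ici_self

lemma IsJet.clm {V U : Type*} [NormedAddCommGroup V] [NormedSpace ℂ V] [NormedAddCommGroup U]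
    [NormedSpace ℂ U] {N : ℕ} {T : ℝ} {F : ℕ → ℝ → V} (hF : IsJet N T F) (B : V →L[ℂ] U) :
    IsJet N T (fun j t => B (F j t)) := fun j hj t ht =>
  (B.restrictScalars ℝ).hasFDerivAt.comp_hasDerivWithinAt t (hF j hj t ht)

lemma IsJet.sub {V : Type*} [NormedAddCommGroup V] [NormedSpace ℝ V] {N : ℕ} {T : ℝ}
    {F G : ℕ → ℝ → V} (hF : IsJet N T F) (hG : IsJet N T G) :
    IsJet N T (fun j t => F j t - G j t) := fun j hj t ht => (hF j hj t ht).sub (hG j hj t ht)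

end Jets

/-! ### Accumulation of the errors -/

section Global

variable {V : Type*} [NormedAddCommGroup V] [NormedSpace ℂ V]

/-- The induction controls `R^m e_j` for all `m` at once, so that the power bound is applied once to
every local error and never compounds. -/
lemma norm_le_of_stable_recursion {R : V →L[ℂ] V} {e : ℕ → V} {C B : ℝ} (hR : ∀ m, ‖R ^ m‖ ≤ C)
    {n : ℕ} (he : ∀ j < n, ‖e (j + 1) - R (e j)‖ ≤ B) : ‖e n‖ ≤ C * (‖e 0‖ + n * B) := by
  have hC : 0 ≤ C := (norm_nonneg _).trans (hR 0)
  have key : ∀ j ≤ n, ∀ m, ‖(R ^ m) (e j)‖ ≤ C * (‖e 0‖ + j * B) := by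
    intro j
    induction j with
    | zero =>
      intro _ m
      simpa using (R ^ m).le_of_opNorm_le (hR m) (e 0)
    | succ j ih =>
      intro hj m
      have h1 : (R ^ m) (e (j + 1)) = (R ^ (m + 1)) (e j) + (R ^ m) (e (j + 1) - R (e j)) := by
        rw [map_sub, pow_succ, mul_apply_eq_comp]
        abel
      have h2 := ih (by omega) (m + 1)
      have h3 := ((R ^ m).le_of_opNorm_le (hR m) (e (j + 1) - R (e j))).trans
        (mul_le_mul_of_nonneg_left (he j (by omega)) hC)
      rw [h1, Nat.cast_succ]
      have h4 := norm_add_le ((R ^ (m + 1)) (e j)) ((R ^ m) (e (j + 1) - R (e j)))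
      linarith
  simpa using key n le_rfl 0

variable {U : Type*} [NormedAddCommGroup U] [NormedSpace ℂ U]

lemma stepF_eq_sub (r : SimpleFractions) (τ : ℝ) (A : V →L[ℂ] V) (K : U →L[ℂ] V) {q : ℕ}
    (d : Fin q → ℝ) (t : ℝ) (g : ℝ → U) (ψ : ℝ → V) : stepF r τ A K d t g =
      stepF r τ A 1 d t ψ - stepF r τ A 1 d t (fun s => ψ s - K (g s)) := by
  simp only [stepF_eq_stepSum, ← stepSum_sub]
  congr 1
  funext l i
  simp only [one_apply_eq_self, ← Finset.sum_sub_distrib, ← smul_sub, sub_sub_cancel]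

variable [CompleteSpace V] [FiniteDimensional ℂ V]

/-- The error of `n` steps of the RL method with respect to a curve `y` that satisfies
`y' = A y + φ - ψ'` up to `δ`, when `ψ` is replaced by `K g` in the method. -/
lemma norm_global_error_le {r : SimpleFractions} {p : ℕ} (hord : r.HasOrder p)
    {A : V →L[ℂ] V} {K : U →L[ℂ] V} {τ M T C κ : ℝ} {c : ℕ → Fin p → ℝ} {d : ℕ → Fin (p + 1) → ℝ}
    (hnodes : AdmissibleNodes p c d) (hτ : 0 < τ)
    (hM : ∀ t : ℝ, 0 ≤ t → ‖expSemigroup A t‖ ≤ M) (hC : ∀ m, ‖r.evalOp τ A ^ m‖ ≤ C)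
    {n : ℕ} (hT : n * τ ≤ T) (hκ : ∀ j < n, kappa r p (c j) (d j) ≤ κ)
    (hTc : ∀ j < n, ∀ k, j * τ + τ * c j k ≤ T) (hTd : ∀ j < n, ∀ k, j * τ + τ * d j k ≤ T)
    {y φ ψ : ℕ → ℝ → V} {g : ℝ → U} {u₀ : V} {Ny Nφ Nψ Nθ δ : ℝ}
    (hy : IsJet (p + 1) T y) (hφ : IsJet p T φ) (hψ : IsJet (p + 1) T ψ)
    (hNy : ∀ t ∈ Icc (0 : ℝ) T, ‖y (p + 1) t‖ ≤ Ny) (hNφ : ∀ t ∈ Icc (0 : ℝ) T, ‖φ p t‖ ≤ Nφ)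
    (hNψ : ∀ t ∈ Icc (0 : ℝ) T, ‖ψ (p + 1) t‖ ≤ Nψ)
    (hδ : ∀ t ∈ Icc (0 : ℝ) T, ‖y 1 t - A (y 0 t) - φ 0 t + ψ 1 t‖ ≤ δ)
    (hNθ : 0 ≤ Nθ) (hθ : ∀ s ∈ Icc (0 : ℝ) T, ∀ t ∈ Icc (0 : ℝ) T,
      ‖(ψ 0 s - K (g s)) - (ψ 0 t - K (g t))‖ ≤ Nθ * |s - t|) :
    ‖y 0 (n * τ) - rlMethod r τ A K c d (φ 0) g u₀ n‖ ≤ C * (‖y 0 0 - u₀‖ + n *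
      (τ * (M * (r.localConst p * (δ + τ ^ p * (Ny + κ * (Nφ + Nψ))) +
        r.stepWeight * r.angleConst * (κ * Nθ))))) := by
  have hM0 : 0 ≤ M := (norm_nonneg _).trans (hM 0 le_rfl)
  have hT0 : (0 : ℝ) ∈ Icc (0 : ℝ) T := ⟨le_rfl, le_trans (by positivity) hT⟩
  have hNφ0 : 0 ≤ Nφ := (norm_nonneg _).trans (hNφ 0 hT0)
  have hNψ0 : 0 ≤ Nψ := (norm_nonneg _).trans (hNψ 0 hT0)
  have h := norm_le_of_stable_recursion (R := r.evalOp τ A) hC (n := n)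
    (e := fun j => y 0 (j * τ) - rlMethod r τ A K c d (φ 0) g u₀ j)
    (B := τ * (M * (r.localConst p * (δ + τ ^ p * (Ny + κ * (Nφ + Nψ))) +
        r.stepWeight * r.angleConst * (κ * Nθ)))) ?_
  · simpa [rlMethod] using h
  intro j hj
  obtain ⟨hc, hd, hc0, hd0⟩ := hnodes j
  have hjn : ((j : ℝ) + 1) * τ ≤ n * τ :=
    mul_le_mul_of_nonneg_right (by exact_mod_cast hj) hτ.le
  have ha : (j : ℝ) * τ ∈ Icc (0 : ℝ) T := ⟨by positivity, by linarith⟩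
  have haT : (j : ℝ) * τ + τ ≤ T := by linarith
  have hcT : ∀ k, (j : ℝ) * τ + τ * c j k ∈ Icc (0 : ℝ) T := fun k =>
    ⟨by have := mul_nonneg hτ.le (hc0 k); linarith, hTc j hj k⟩
  have hdT : ∀ k, (j : ℝ) * τ + τ * d j k ∈ Icc (0 : ℝ) T := fun k =>
    ⟨by have := mul_nonneg hτ.le (hd0 k); linarith, hTd j hj k⟩
  have hloc := norm_local_error_le hord hτ hM ha haT hc hd hcT hdT hy hφ hψ hNy hNφ hNψ hδ
  have hF := norm_stepF_le r hτ hM (c j) hd (θ := fun s => ψ 0 s - K (g s)) (a := j * τ) (N := Nθ)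
    (fun k => by
      have := hθ _ (hdT k) _ ha
      rwa [add_sub_cancel_left, abs_mul, abs_of_pos hτ] at this) hNθ
  -- The local defect is the error of a step with the forcing `ψ`, minus the boundary part of a step
  -- applied to `ψ - K g`.
  have hsplit : y 0 ((j + 1 : ℕ) * τ) - rlMethod r τ A K c d (φ 0) g u₀ (j + 1) -
      r.evalOp τ A (y 0 (j * τ) - rlMethod r τ A K c d (φ 0) g u₀ j) =
      (y 0 (j * τ + τ) - (r.evalOp τ A (y 0 (j * τ)) + (τ : ℂ) • stepE r τ A (c j) (j * τ) (φ 0) -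
        stepF r τ A 1 (d j) (j * τ) (ψ 0))) -
      stepF r τ A 1 (d j) (j * τ) (fun s => ψ 0 s - K (g s)) := by
    have : ((j + 1 : ℕ) : ℝ) * τ = j * τ + τ := by push_cast; ring
    rw [this, rlMethod, stepF_eq_sub r τ A K (d j) (j * τ) g (ψ 0), map_sub]
    abel
  rw [hsplit]
  have hlc := r.localConst_nonneg p
  have hsw := r.stepWeight_nonneg
  have han := r.angleConst_nonneg
  have hkj := hκ j hj
  calc _ ≤ M * r.localConst p * τ * (δ + τ ^ p * (Ny + kappa r p (c j) (d j) * (Nφ + Nψ))) +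
      r.stepWeight * (M * r.angleConst) * (τ * (kappa r p (c j) (d j) * Nθ)) :=
        (norm_sub_le _ _).trans (add_le_add hloc hF)
    _ ≤ M * r.localConst p * τ * (δ + τ ^ p * (Ny + κ * (Nφ + Nψ))) +
      r.stepWeight * (M * r.angleConst) * (τ * (κ * Nθ)) := by gcongr
    _ = _ := by ring

end Global

/-! ### The full discretization -/

namespace ConsistencySpaces

variable {X Y W Z : Type*} [NormedAddCommGroup X] [NormedSpace ℂ X] [CompleteSpace X]
  [NormedAddCommGroup Y] [NormedSpace ℂ Y]
  [NormedAddCommGroup W] [NormedSpace ℂ W] [NormedAddCommGroup Z] [NormedSpace ℂ Z]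
  {P : BoundaryProblem X Y} (S : ConsistencySpaces P W Z)

/-- Subtracting the stationary solution with the same boundary value does not change `A w`, and
maps `W` to `W₀`. -/
lemma sub_stationary {k : Z →L[ℂ] W} (hk : ∀ z, S.incW (k z) = P.K0 (S.incZ z))
    {β : W →L[ℂ] Z} (hβ : ∀ w, S.incZ (β w) = P.bd (S.toDomain w)) (w : W) :
    w - k (β w) ∈ S.W0 ∧ P.A (S.toDomain (w - k (β w))) = P.A (S.toDomain w) := by
  obtain ⟨hv, hA, hbd⟩ := P.K0_spec (S.incZ (β w))
  have h : S.toDomain (k (β w)) = ⟨_, hv⟩ := Subtype.ext (hk (β w))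
  constructor
  · change P.bd (S.toDomain (w - k (β w))) = 0
    rw [map_sub, map_sub, h, hbd, hβ, sub_self]
  · rw [map_sub, LinearPMap.map_sub, h, hA, sub_zero]

end ConsistencySpaces

namespace SpaceDiscretization

variable {X Y : Type*} [NormedAddCommGroup X] [NormedSpace ℂ X]
  [NormedAddCommGroup Y] [NormedSpace ℂ Y] {h₀ : ℝ} {Xh Yh : Ioc (0 : ℝ) h₀ → Type*}
  [∀ h, NormedAddCommGroup (Xh h)] [∀ h, NormedSpace ℂ (Xh h)]
  [∀ h, NormedAddCommGroup (Yh h)] [∀ h, NormedSpace ℂ (Yh h)]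
  {D : SpaceDiscretization X Y h₀ Xh Yh} {r : SimpleFractions}

lemma Stable.norm_Ph0_le (hstab : D.Stable r) (h : Ioc (0 : ℝ) h₀) : ‖D.Ph0 h‖ ≤ D.L :=
  ((le_max_left _ _).trans (le_max_right _ _)).trans (le_ciSup hstab.bddL h)

lemma Stable.norm_expSemigroup_le (hstab : D.Stable r) (h : Ioc (0 : ℝ) h₀) {t : ℝ} (ht : 0 ≤ t) :
    ‖expSemigroup (D.Ah0 h) t‖ ≤ D.Ms :=
  le_ciSup hstab.bddMs (h, (⟨t, ht⟩ : Ici (0 : ℝ)))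

lemma Stable.norm_evalOp_pow_le (hstab : D.Stable r) (h : Ioc (0 : ℝ) h₀) {τ : ℝ} (hτ : 0 < τ)
    (n : ℕ) : ‖r.evalOp τ (D.Ah0 h) ^ n‖ ≤ D.Cs r :=
  le_ciSup hstab.bddCs (h, (⟨τ, hτ⟩ : Ioi (0 : ℝ)), n)

end SpaceDiscretization

/-- The temporal and the spatial part of the error bound, collected. -/
lemma error_bound_le (p : ℕ) {n τ κ κ₀ cw cf cg L M C lc sw ε N b v C₁ C₂ C₃ C₄ C' : ℝ}
    (hn : n * τ = 0 ∨ 1 ≤ κ) (hκ₀ : 0 ≤ κ₀) (hcw : 0 ≤ cw) (hcf : 0 ≤ cf) (hcg : 0 ≤ cg)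
    (hL : 0 ≤ L) (hM : 0 ≤ M) (hC : 0 ≤ C) (hlc : 0 ≤ lc) (hsw : 0 ≤ sw) (hεN : 0 ≤ ε * N)
    (hb : 0 ≤ b) (hv : 0 ≤ v) (ht : 0 ≤ n * τ) (hτ : 0 ≤ τ)
    (h₁ : 0 ≤ C₁) (h₂ : 0 ≤ C₂) (h₃ : 0 ≤ C₃) (h₄ : 0 ≤ C₄) (h' : 0 ≤ C') :
    C * (C₄ * ε * (b * N) + n * (τ * (M * (lc * (C₁ * ε * (v * N) + τ ^ p * (L * (cw + κ₀ * cg) +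
      κ * (L * cf + L * (κ₀ * cg)))) + sw * (κ * (C₄ * ε * (b * N))))))) +
      C' * (C₂ * ε) * (v * N) + C₃ * ε * (b * N) ≤
    (C * M * L * (lc + κ * lc * (1 + κ₀))) * τ ^ p * (n * τ) * (1 + 2 * (n * τ)) *
        (cw + cf + cg + κ₀ * cg) +
      (1 + (n * τ) * M) * ((C₃ * b + C' * C₂ * v + C * (C₄ * b) +
        C * (lc * (C₁ * v) + sw * (|κ| * (C₄ * b)))) * ε) * N := by
  set t := n * τ with htdef
  set B := cw + cf + cg + κ₀ * cg with hB
  have hB0 : 0 ≤ B := by positivity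
  have hCM : 0 ≤ C * M := mul_nonneg hC hM
  have hτp : 0 ≤ τ ^ p := pow_nonneg hτ p
  have hERT : t * (lc * (τ ^ p * (L * (cw + κ₀ * cg) + κ * (L * cf + L * (κ₀ * cg))))) ≤
      L * (lc + κ * lc * (1 + κ₀)) * τ ^ p * t * (1 + 2 * t) * B := by
    -- For `n = 0` no `kappa` bounds `κ` from below, so `κ` may be negative; then both sides are
    -- zero.
    rcases hn with hn | hκ1
    · simp [hn]
    have hκ0 : 0 ≤ κ := zero_le_one.trans hκ1
    have hκg : 0 ≤ κ₀ * cg := mul_nonneg hκ₀ hcg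
    have e1 : L * (cw + κ₀ * cg) ≤ L * B :=
      mul_le_mul_of_nonneg_left (by rw [hB]; linarith) hL
    have e2 : L * cf + L * (κ₀ * cg) ≤ L * B * (1 + κ₀) := by
      rw [← mul_add]
      refine le_trans ?_ (le_mul_of_one_le_right (by positivity) (by linarith))
      exact mul_le_mul_of_nonneg_left (by rw [hB]; linarith) hL
    calc _ ≤ t * (lc * (τ ^ p * (L * B + κ * (L * B * (1 + κ₀))))) := by gcongr
      -- The estimate holds without the factor `1 + 2 t`, which is inserted here.
      _ = L * (lc + κ * lc * (1 + κ₀)) * τ ^ p * t * B * 1 := by ring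
      _ ≤ L * (lc + κ * lc * (1 + κ₀)) * τ ^ p * t * B * (1 + 2 * t) :=
        mul_le_mul_of_nonneg_left (by linarith) (by positivity)
      _ = _ := by ring
  have hERS : t * (sw * (κ * (C₄ * b))) * (ε * N) ≤ t * (sw * (|κ| * (C₄ * b))) * (ε * N) := by
    gcongr
    exact le_abs_self κ
  have e1 := mul_le_mul_of_nonneg_left hERT hCM
  have e2 := mul_le_mul_of_nonneg_left hERS hCM
  have e3 : 0 ≤ t * M * (C₃ * b + C' * C₂ * v + C * (C₄ * b)) * (ε * N) := by positivity
  have e4 : 0 ≤ C * (lc * (C₁ * v) + sw * (|κ| * (C₄ * b))) * (ε * N) := by positivity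
  calc _ = C * M * (t * (lc * (τ ^ p * (L * (cw + κ₀ * cg) + κ * (L * cf + L * (κ₀ * cg)))))) +
        C * M * (t * (sw * (κ * (C₄ * b))) * (ε * N)) +
        (C₃ * b + C' * C₂ * v + C * (C₄ * b)) * (ε * N) +
        t * M * (C * (lc * (C₁ * v))) * (ε * N) := by rw [htdef]; ring
    -- The last two summands are slack: they complete the product of `1 + t M` with the collected
    -- spatial constant.
    _ ≤ C * M * (L * (lc + κ * lc * (1 + κ₀)) * τ ^ p * t * (1 + 2 * t) * B) +
        C * M * (t * (sw * (|κ| * (C₄ * b))) * (ε * N)) +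
        (C₃ * b + C' * C₂ * v + C * (C₄ * b)) * (ε * N) +
        t * M * (C * (lc * (C₁ * v))) * (ε * N) +
        t * M * (C₃ * b + C' * C₂ * v + C * (C₄ * b)) * (ε * N) +
        C * (lc * (C₁ * v) + sw * (|κ| * (C₄ * b))) * (ε * N) := by linarith
    _ = _ := by ring

end RLMethod

open RLMethod in
theorem mainTheorem3 (p : ℕ) (hp : 1 ≤ p) (r : RLMethod.SimpleFractions)
    (hacc : r.AAcceptable) (hord : r.HasOrder p) :
    -- `Cel` and `Caux` depend only on `r` and `p`
    ∃ Cel Caux : ℝ, 0 ≤ Cel ∧ 0 ≤ Caux ∧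
    ∀ (X Y W Z : Type*)
      [NormedAddCommGroup X] [NormedSpace ℂ X] [CompleteSpace X]
      [NormedAddCommGroup Y] [NormedSpace ℂ Y] [CompleteSpace Y]
      [NormedAddCommGroup W] [NormedSpace ℂ W] [CompleteSpace W]
      [NormedAddCommGroup Z] [NormedSpace ℂ Z] [CompleteSpace Z]
      (P : RLMethod.BoundaryProblem X Y) (S : RLMethod.ConsistencySpaces P W Z)
      (h₀ : ℝ) (_hh₀ : 0 < h₀) (Xh Yh : Set.Ioc (0 : ℝ) h₀ → Type*)
      [∀ h, NormedAddCommGroup (Xh h)] [∀ h, NormedSpace ℂ (Xh h)]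
      [∀ h, FiniteDimensional ℂ (Xh h)]
      [∀ h, NormedAddCommGroup (Yh h)] [∀ h, NormedSpace ℂ (Yh h)]
      [∀ h, FiniteDimensional ℂ (Yh h)]
      (D : RLMethod.SpaceDiscretization X Y h₀ Xh Yh) (ε : Set.Ioc (0 : ℝ) h₀ → ℝ)
      (_hstab : D.Stable r) (_hcons : D.Consistent S ε) (κ : ℝ),
      -- the constant hidden in `O(ε(h))`
      ∃ Csp : ℝ, 0 ≤ Csp ∧
      ∀ (c : ℕ → Fin p → ℝ) (d : ℕ → Fin (p + 1) → ℝ) (_hnodes : RLMethod.AdmissibleNodes p c d)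
        (w₀ : X) (f : ℝ → X) (g : ℝ → Z) (w : ℝ → W)
        (_hsol : S.IsSolution w₀ f g w)
        (_hwW : RLMethod.IsCub 1 w) (_hwX : RLMethod.IsCub (p + 1) (fun t => S.incW (w t)))
        (_hf : RLMethod.IsCub (p + 1) f) (_hg : RLMethod.IsCub (p + 2) g)
        (h : Set.Ioc (0 : ℝ) h₀) (τ : ℝ) (_hτ : 0 < τ) (n : ℕ)
        (_hκ : ∀ j < n, RLMethod.kappa r p (c j) (d j) ≤ κ)
        -- `[0, T]` contains `t_n` and all the nodes used in the first `n` steps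
        (T : ℝ) (_hT : n * τ ≤ T)
        (_hTc : ∀ j < n, ∀ k, j * τ + τ * c j k ≤ T)
        (_hTd : ∀ j < n, ∀ k, j * τ + τ * d j k ≤ T),
        ‖D.wFull r c d τ w₀ f (fun t => S.incZ (g t)) h n - D.Ph h (S.incW (w (n * τ)))‖ ≤
          (D.Cs r * D.Ms * D.L * (Cel + κ * Caux * (1 + ‖P.K0‖))) *
              τ ^ p * (n * τ) * (1 + 2 * (n * τ)) *
              (RLMethod.tripleNorm (p + 1) T (fun t => S.incW (w t)) f (fun t => S.incZ (g t)) +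
                ‖P.K0‖ * RLMethod.cNorm (p + 2) T (fun t => S.incZ (g t)))
          + (1 + (n * τ) * D.Ms) * (Csp * ε h) * RLMethod.cNorm 1 T w := by
  -- One constant of the one-step error serves for both `Cel` and `Caux`.
  refine ⟨r.localConst p, r.localConst p, r.localConst_nonneg p, r.localConst_nonneg p, ?_⟩
  intro X Y W Z _ _ _ _ _ _ _ _ _ _ _ _ P S h₀ _ Xh Yh _ _ _ _ _ _ D ε hstab hcons κ
  obtain ⟨β, hβ⟩ := S.exists_clm_trace
  obtain ⟨k, hk⟩ := S.exists_clm_stationary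
  obtain ⟨C', hC'⟩ := hcons.proj
  obtain ⟨C₁, hC₁⟩ := hcons.C1
  obtain ⟨C₂, hC₂⟩ := hcons.C2
  obtain ⟨C₃, hC₃⟩ := hcons.C3
  obtain ⟨C₄, hC₄⟩ := hcons.C4
  have hlc := r.localConst_nonneg p
  have hsw := r.stepWeight_nonneg
  have han := r.angleConst_nonneg
  have hCs0 : 0 ≤ D.Cs r := Real.iSup_nonneg fun _ => norm_nonneg _
  have hMs0 : 0 ≤ D.Ms := Real.iSup_nonneg fun _ => norm_nonneg _
  have hL0 : 0 ≤ D.L := Real.iSup_nonneg fun _ => (norm_nonneg _).trans (le_max_left _ _)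
  set b := ‖β‖ with hb
  set v := 1 + ‖k‖ * b with hv
  have hb0 : 0 ≤ b := norm_nonneg _
  have hv0 : 0 ≤ v := by positivity
  -- In order: the stationary part, the projection error on `W₀`, the initial error, and the
  -- accumulated residual and boundary errors. Absolute values are taken because the consistency
  -- constants and `κ` carry no sign.
  refine ⟨|C₃| * b + |C'| * |C₂| * v + D.Cs r * (|C₄| * b) + D.Cs r *
    (r.localConst p * (|C₁| * v) + r.stepWeight * r.angleConst * (|κ| * (|C₄| * b))), by positivity,
    ?_⟩
  intro c d hnodes w₀ f g w hsol hwW hwX hf hg h τ hτ n hκ T hT hTc hTd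
  have hε := hcons.eps_pos h
  have hT0 : (0 : ℝ) ≤ T := le_trans (by positivity) hT
  have h0T : (0 : ℝ) ∈ Icc (0 : ℝ) T := ⟨le_rfl, hT0⟩
  have hnT : (n : ℝ) * τ ∈ Icc (0 : ℝ) T := ⟨by positivity, hT⟩
  set N := cNorm 1 T w with hN
  have hN0 : 0 ≤ N := cNorm_nonneg _ _ _
  have hwN : ∀ t ∈ Icc (0 : ℝ) T, ‖w t‖ ≤ N := fun t ht => by
    simpa using norm_iteratedDerivWithin_le_cNorm hwW.1 (j := 0) (by omega) ht
  have hwLip : ∀ s ∈ Icc (0 : ℝ) T, ∀ t ∈ Icc (0 : ℝ) T, ‖w s - w t‖ ≤ N * |s - t| := by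
    intro s hs t ht
    have := norm_sub_taylorSum_le (isJet_iteratedDerivWithin hwW.1 T)
      (fun t ht => norm_iteratedDerivWithin_le_cNorm hwW.1 le_rfl ht) ht hs
    simpa [taylorSum] using this
  have hgβ : ∀ t, 0 ≤ t → β (w t) = g t := fun t ht =>
    S.incZ_injective ((hβ _).trans (hsol.2 t ht).2)
  set gY : ℝ → Y := fun t => S.incZ (g t) with hgY
  set wX : ℝ → X := fun t => S.incW (w t) with hwXdef
  have hgYc : ContDiffOn ℝ (p + 2 : ℕ) gY (Ici 0) :=
    (S.incZ.restrictScalars ℝ).contDiff.comp_contDiffOn hg.1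
  -- The boundary value is written as `β (w t)` instead of `g t`, so that the norms of `v₀` and of
  -- `g` in `Z` are controlled by `w` in `W` alone.
  set v₀ : ℝ → W := fun t => w t - k (β (w t)) with hv₀
  have hv₀W : ∀ t, v₀ t ∈ S.W0 := fun t => (S.sub_stationary hk hβ (w t)).1
  have hv₀A : ∀ t, P.A (S.toDomain (v₀ t)) = P.A (S.toDomain (w t)) := fun t =>
    (S.sub_stationary hk hβ (w t)).2
  have hv₀X : ∀ t, 0 ≤ t → S.incW (v₀ t) = wX t - P.K0 (gY t) := fun t ht => by
    rw [hv₀, map_sub, hk, hgβ t ht]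
  have hv₀N : ∀ t ∈ Icc (0 : ℝ) T, ‖v₀ t‖ ≤ v * N := fun t ht => by
    have h1 := norm_sub_le (w t) (k (β (w t)))
    have h2 := (k.le_opNorm (β (w t))).trans
      (mul_le_mul_of_nonneg_left (β.le_opNorm (w t)) (norm_nonneg k))
    have h3 := hwN t ht
    have h4 : ‖k‖ * (‖β‖ * ‖w t‖) ≤ ‖k‖ * (‖β‖ * N) := by gcongr
    calc _ ≤ _ := h1
      _ ≤ N + ‖k‖ * (‖β‖ * N) := add_le_add h3 (h2.trans h4)
      _ = v * N := by rw [hv, hb]; ring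
  have habs : ∀ C x : ℝ, 0 ≤ x → C * ε h * x ≤ |C| * ε h * x := fun C x hx => by
    gcongr; exact le_abs_self C
  have : CompleteSpace (D.bdh h).ker := FiniteDimensional.complete ℂ _
  have hM := fun t ht => hstab.norm_expSemigroup_le h (t := t) ht
  have hPh0 : ∀ x, ‖D.Ph0 h x‖ ≤ D.L * ‖x‖ := (D.Ph0 h).le_of_opNorm_le (hstab.norm_Ph0_le h)
  set jw : ℕ → ℝ → X := fun j => iteratedDerivWithin j wX (Ici 0) with hjw
  set jg : ℕ → ℝ → Y := fun j => iteratedDerivWithin j gY (Ici 0) with hjg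
  set jf : ℕ → ℝ → X := fun j => iteratedDerivWithin j f (Ici 0) with hjf
  have hjw0 : jw 0 = wX := iteratedDerivWithin_zero
  have hjg0 : jg 0 = gY := iteratedDerivWithin_zero
  have hjf0 : jf 0 = f := iteratedDerivWithin_zero
  have hJw : IsJet (p + 1) T jw := isJet_iteratedDerivWithin hwX.1 T
  have hJg : IsJet (p + 1) T jg := (isJet_iteratedDerivWithin hgYc T).mono (by omega)
  have hJf : IsJet p T jf := (isJet_iteratedDerivWithin hf.1 T).mono (by omega)
  set cw := cNorm (p + 1) T wX with hcw
  set cf := cNorm (p + 1) T f with hcf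
  set cg := cNorm (p + 2) T gY with hcg
  have hcw0 : 0 ≤ cw := cNorm_nonneg _ _ _
  have hcf0 : 0 ≤ cf := cNorm_nonneg _ _ _
  have hcg0 : 0 ≤ cg := cNorm_nonneg _ _ _
  set y : ℕ → ℝ → (D.bdh h).ker := fun j t => D.Ph0 h (jw j t - P.K0 (jg j t)) with hy
  set φ : ℕ → ℝ → (D.bdh h).ker := fun j t => D.Ph0 h (jf j t) with hφ
  set ψ : ℕ → ℝ → (D.bdh h).ker := fun j t => D.Ph0 h (P.K0 (jg j t)) with hψ
  have hK : ∀ t ∈ Icc (0 : ℝ) T, ‖P.K0 (jg (p + 1) t)‖ ≤ ‖P.K0‖ * cg := fun t ht =>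
    (P.K0.le_opNorm _).trans (mul_le_mul_of_nonneg_left
      (norm_iteratedDerivWithin_le_cNorm hgYc (by omega) ht) (norm_nonneg _))
  have hNy : ∀ t ∈ Icc (0 : ℝ) T, ‖y (p + 1) t‖ ≤ D.L * (cw + ‖P.K0‖ * cg) := fun t ht =>
    (hPh0 _).trans (mul_le_mul_of_nonneg_left ((norm_sub_le _ _).trans
      (add_le_add (norm_iteratedDerivWithin_le_cNorm hwX.1 le_rfl ht) (hK t ht))) hL0)
  have hNφ : ∀ t ∈ Icc (0 : ℝ) T, ‖φ p t‖ ≤ D.L * cf := fun t ht =>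
    (hPh0 _).trans (mul_le_mul_of_nonneg_left
      (norm_iteratedDerivWithin_le_cNorm hf.1 (by omega) ht) hL0)
  have hNψ : ∀ t ∈ Icc (0 : ℝ) T, ‖ψ (p + 1) t‖ ≤ D.L * (‖P.K0‖ * cg) := fun t ht =>
    (hPh0 _).trans (mul_le_mul_of_nonneg_left (hK t ht) hL0)
  -- The differential equation for `w` reduces the residual to the commutator of `P_{h,0}` with
  -- `A₀`, evaluated at `v₀ t`.
  have hδ : ∀ t ∈ Icc (0 : ℝ) T, ‖y 1 t - D.Ah0 h (y 0 t) - φ 0 t + ψ 1 t‖ ≤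
      |C₁| * ε h * (v * N) := by
    intro t ht
    have hw1 : jw 1 t = P.A (S.toDomain (w t)) + f t := by
      rw [hjw]
      simp only [iteratedDerivWithin_one]
      exact (hsol.2 t ht.1).1.derivWithin (uniqueDiffOn_Ici 0 t ht.1)
    have h1 : y 1 t - D.Ah0 h (y 0 t) - φ 0 t + ψ 1 t =
        -(D.Ah0 h (D.Ph0 h (S.incW (v₀ t))) - D.Ph0 h (P.A (S.toDomain (v₀ t)))) := by
      simp only [hy, hφ, hψ, hjw0, hjg0, hjf0]
      rw [hv₀X t ht.1, hv₀A, hw1]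
      simp only [map_sub, map_add]
      abel
    rw [h1, norm_neg]
    refine (hC₁ h _ (hv₀W t)).trans ((habs _ _ (norm_nonneg _)).trans ?_)
    gcongr
    exact hv₀N t ht
  have hθz : ∀ z, ‖D.Ph0 h (P.K0 (S.incZ (β z))) - D.Kh0 h (D.Qh h (S.incZ (β z)))‖ ≤
      |C₄| * ε h * (b * ‖z‖) := fun z => by
    refine (hC₄ h _).trans ((habs _ _ (norm_nonneg _)).trans ?_)
    gcongr
    exact β.le_opNorm z
  -- The difference `ψ - K_{h,0} Q_h g` is a fixed linear operator of size `O(ε(h))` applied to `w`,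
  -- so the Lipschitz bound of `w` in `W` carries over.
  have hθ : ∀ s ∈ Icc (0 : ℝ) T, ∀ t ∈ Icc (0 : ℝ) T,
      ‖(ψ 0 s - D.Kh0 h (D.Qh h (gY s))) - (ψ 0 t - D.Kh0 h (D.Qh h (gY t)))‖ ≤
        |C₄| * ε h * (b * N) * |s - t| := by
    intro s hs t ht
    have h1 : (ψ 0 s - D.Kh0 h (D.Qh h (gY s))) - (ψ 0 t - D.Kh0 h (D.Qh h (gY t))) =
        D.Ph0 h (P.K0 (S.incZ (β (w s - w t)))) -
          D.Kh0 h (D.Qh h (S.incZ (β (w s - w t)))) := by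
      simp only [hψ, hjg0, hgY, map_sub, hgβ s hs.1, hgβ t ht.1]
      abel
    rw [h1]
    refine (hθz _).trans ?_
    rw [mul_assoc (|C₄| * ε h), mul_assoc b]
    gcongr
    exact hwLip s hs t ht
  have hglob := norm_global_error_le (K := D.Kh0 h) (g := fun t => D.Qh h (gY t))
    (u₀ := D.Ph0 h w₀ - D.Kh0 h (D.Qh h (gY 0))) hord hnodes hτ hM
    (fun m => hstab.norm_evalOp_pow_le h hτ m) hT hκ hTc hTd ((hJw.sub (hJg.clm P.K0)).clm (D.Ph0 h))
    (hJf.clm (D.Ph0 h)) ((hJg.clm P.K0).clm (D.Ph0 h)) hNy hNφ hNψ hδ (by positivity) hθ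
  have he0 : ‖y 0 0 - (D.Ph0 h w₀ - D.Kh0 h (D.Qh h (gY 0)))‖ ≤ |C₄| * ε h * (b * N) := by
    have h1 : y 0 0 - (D.Ph0 h w₀ - D.Kh0 h (D.Qh h (gY 0))) =
        -(D.Ph0 h (P.K0 (S.incZ (β (w 0)))) - D.Kh0 h (D.Qh h (S.incZ (β (w 0))))) := by
      simp only [hy, hjw0, hjg0, hgY, hwXdef, hsol.1, hgβ 0 le_rfl, map_sub]
      abel
    rw [h1, norm_neg]
    refine (hθz _).trans ?_
    gcongr
    exact hwN 0 h0T
  have hproj : ‖D.Ph h (S.incW (v₀ (n * τ))) - (D.Ph0 h (S.incW (v₀ (n * τ))) : Xh h)‖ ≤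
      |C'| * (|C₂| * ε h) * (v * N) := by
    have hop : ‖((D.bdh h).comp ((D.Ph h).comp S.incW)).comp S.W0.subtypeL‖ ≤ |C₂| * ε h :=
      ContinuousLinearMap.opNorm_le_bound _ (by positivity) fun x =>
        (hC₂ h x x.2).trans (habs _ _ (norm_nonneg _))
    refine (hC' h _ (hv₀W _)).trans ?_
    calc _ ≤ |C'| * ‖((D.bdh h).comp ((D.Ph h).comp S.incW)).comp S.W0.subtypeL‖ *
          ‖v₀ (n * τ)‖ := by gcongr; exact le_abs_self C'
      _ ≤ _ := by gcongr; exact hv₀N _ hnT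
  have hstat : ‖D.Ph h (P.K0 (gY (n * τ))) - D.Kh h (D.Qh h (gY (n * τ)))‖ ≤
      |C₃| * ε h * (b * N) := by
    refine (hC₃ h _).trans ((habs _ _ (norm_nonneg _)).trans ?_)
    rw [← hgβ _ hnT.1]
    gcongr
    exact (β.le_opNorm _).trans (mul_le_mul_of_nonneg_left (hwN _ hnT) hb0)
  have hφ0 : φ 0 = fun t => D.Ph0 h (f t) := by simp only [hφ, hjf0]
  -- Writing `w = v₀ + K(0) g` separates the error of the method in `X_{h,0}`, the discrepancy of
  -- the two projections on `W₀`, and the stationary error.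
  have hsplit : D.wFull r c d τ w₀ f gY h n - D.Ph h (wX (n * τ)) =
      -(((y 0 (n * τ) - rlMethod r τ (D.Ah0 h) (D.Kh0 h) c d (φ 0) (fun t => D.Qh h (gY t))
        (D.Ph0 h w₀ - D.Kh0 h (D.Qh h (gY 0))) n : (D.bdh h).ker) : Xh h)) -
      (D.Ph h (S.incW (v₀ (n * τ))) - (D.Ph0 h (S.incW (v₀ (n * τ))) : Xh h)) -
      (D.Ph h (P.K0 (gY (n * τ))) - D.Kh h (D.Qh h (gY (n * τ)))) := by
    have h1 : y 0 (n * τ) = D.Ph0 h (S.incW (v₀ (n * τ))) := by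
      simp only [hy, hjw0, hjg0]
      rw [hv₀X _ hnT.1]
    have h2 : D.Ph h (wX (n * τ)) = D.Ph h (S.incW (v₀ (n * τ))) + D.Ph h (P.K0 (gY (n * τ))) := by
      rw [hv₀X _ hnT.1, ← map_add, sub_add_cancel]
    rw [h1, h2, SpaceDiscretization.wFull, SpaceDiscretization.uFull, hφ0]
    simp only [Submodule.coe_sub]
    abel
  rw [hsplit]
  refine (norm_sub_le _ _).trans ?_
  refine (add_le_add_left (norm_sub_le _ _) _).trans ?_
  rw [norm_neg]
  have hn : n * τ = 0 ∨ 1 ≤ κ := by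
    rcases Nat.eq_zero_or_pos n with hn | hn
    · left; simp [hn]
    · exact Or.inr ((one_le_kappa r p (c 0) (d 0)).trans (hκ 0 hn))
  refine le_trans ?_ (error_bound_le p hn (norm_nonneg P.K0) hcw0 hcf0 hcg0 hL0 hMs0 hCs0 hlc
    (mul_nonneg hsw han) (mul_nonneg hε.le hN0) hb0 hv0 hnT.1 hτ.le (abs_nonneg C₁) (abs_nonneg C₂)
    (abs_nonneg C₃) (abs_nonneg C₄) (abs_nonneg C'))
  refine add_le_add (add_le_add (hglob.trans ?_) hproj) hstat
  exact mul_le_mul_of_nonneg_left (add_le_add_left he0 _) hCs0
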